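/- **Setting.** For $0\le\beta<\alpha\le1$ let $A_{\alpha,\beta}\in\mathbb R^{n\times n}$ be the lower-triangular Toeplitz matrix with subdiagonals $a_k=\frac{\alpha^{k+1}-\beta^{k+1}}{\alpha-\beta}$, and let $B_{\alpha,\beta}\in\mathbb R^{n\times n}$ be the lower-triangular Toeplitz matrix with subdiagonals $b_j=\sum_{i=0}^{j}\alpha^{j-i}\gamma(j-i)\gamma(i)\beta^i$, where $\gamma(k)=4^{-k}\binom{2k}{k}$; it satisfies $B_{\alpha,\beta}^2=A_{\alpha,\beta}$. *Errors.* For a factorization $LR$ and $\epsilon,\delta\in(0,1)$ let $\Delta$ be the maximum of $\|R(x-x')\|_2$ over $x,x'\in\{0,1\}^n$ that differ in exactly one coordinate, and let $z$ have independent $\mathcal N(0,C_{\epsilon,\delta}\Delta^2)$ coordinates, $C_{\epsilon,\delta}=2\ln(1.25/\delta)/\epsilon^2$. Then $\mathrm{MSE}(L,R)=\frac1n\mathbb E\|Lz\|_2^2$ and $\mathrm{MaxSE}(L,R)=\max_i\mathbb E\,(Lz)_i^2$. *Binnings.* A binning of $[n]$ is a sequence $\mathcal B=(\mathcal B^1,\dots,\mathcal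 B^n)$, where $\mathcal B^i$ is a partition of $\{1,\dots,i\}$ into intervals and each interval of $\mathcal B^i$ is contained in one of $\mathcal B^{i+1}$; its size is $|\mathcal B|=\max_i|\mathcal B^i|$. The $\mathcal B$-approximation of a lower-triangular $L$ is the lower-triangular $\hat L$ with $\hat L_{i,j}=\frac{L_{i,a}+L_{i,b}}2$ for $j\in[a,b]\in\mathcal B^i$. *Algorithm 1* (input: $L\ge0$ and $c,\tau\in(0,1)$). Start with $\mathcal B^0=\emptyset$. For $i=1,\dots,n$, go through the intervals of $\mathcal B^{i-1}$ from right to left. At the current interval $[a,b]$: if there is an interval to its left, $L_{i,b+1}>0$ and $L_{i,a}/L_{i,b+1}>c$, then, as long as there is a next interval $[a',b']$ to the left and $L_{i,a'}/L_{i,b+1}\ge c^2$, merge it into the current one (replace $a$ by $a'$). Afterwards, if $L_{i,b}\le\tau$, add $[1,b]$ to $\mathcal B^i$ and stop going through $\mathcal B^{i-1}$; otherwise add $[a,b]$ to $\mathcal B^i$ and go on with the next interval to the left that has not been merged. Finally add $[i,i]$ to $\mathcal B^i$. *Space.* The space complexity of a lower-triangular $L$ is the smallest $q$ for which there are linear maps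 $U_1,\dots,U_n:\mathbb R^q\times\mathbb R\to\mathbb R^q\times\mathbb R$ such that for every $z\in\mathbb R^n$, starting from the state $s_0=0$, one has $U_i(s_{i-1},z_i)=(s_i,(Lz)_i)$ for all $i$. *Time.* Time is counted on a real RAM with random access to the entries of $B_{\alpha,\beta}$: each arithmetic operation or comparison of reals, each increment, decrement or comparison of integers, and each access to a register, an array cell or an entry of $B_{\alpha,\beta}$ costs one unit. **Theorem.** There are a fixed real-RAM program and an absolute constant $K$ such that the following holds for all $0\le\beta<\alpha\le1$ and $\xi\in(0,1)$. There is a constant $C=C(\alpha,\beta,\xi)$ such that for every $n\ge1$ there are $c,\tau\in(0,1)$ for which the output $\mathcal B$ of Algorithm 1 on $B_{\alpha,\beta}\in\mathbb R^{n\times n}$ with parameters $c,\tau$ is a binning of $[n]$ with, if $n\ge2$, $$|\mathcal B|\le\begin{cases}C\sqrt n\log n&\text{if }\alpha=1,\\ C\log n&\text{otherwise,}\end{cases}$$ and the $\mathcal B$-approximation $\hat L$ of $B_{\alpha,\beta}$ is invertible and, with $\hat R=\hat L^{-1}B_{\alpha,\beta}^2$, induces a factorization $\hat L\hat R=B_{\alpha,\beta}^2=A_{\alpha,\beta}$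 such that - for all $\epsilon,\delta\in(0,1)$: $\mathrm{MSE}(\hat L,\hat R)\le(1+\xi)\,\mathrm{MSE}(B_{\alpha,\beta},B_{\alpha,\beta})$ and $\mathrm{MaxSE}(\hat L,\hat R)\le(1+\xi)\,\mathrm{MaxSE}(B_{\alpha,\beta},B_{\alpha,\beta})$; - $\hat L$ has space complexity at most $|\mathcal B|$; - for every $z\in\mathbb R^n$, the program, given $c,\tau$ and random access to $B_{\alpha,\beta}$, reads $z_1,\dots,z_n$ one after the other and, after reading $z_i$ and before reading $z_{i+1}$, outputs $(\hat Lz)_i$ within time $K\,|\mathcal B|$. -/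

import Mathlib

open MeasureTheory ProbabilityTheory Matrix

noncomputable section

/-! Rows and columns are numbered from `0`: row `i` of the code is row `i + 1` in the usual
numbering, and the partition attached to row `i` is a partition of `{0, …, i}`. -/

/-! ### The counting matrix with momentum and weight decay, and its square root -/

/-- The lower-triangular Toeplitz matrix with subdiagonals
`a_k = (α^(k+1) - β^(k+1)) / (α - β)`. -/
def countingMatrix (α β : ℝ) (n : ℕ) : Matrix (Fin n) (Fin n) ℝ :=
  Matrix.of fun i j =>
    if j ≤ i then
      (α ^ ((i : ℕ) - (j : ℕ) + 1) - β ^ ((i : ℕ) - (j : ℕ) + 1)) / (α - β)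
    else 0

/-- `γ(k) = 4^(-k) * binom(2k, k)`. -/
def gammaCoeff (k : ℕ) : ℝ := (Nat.centralBinom k : ℝ) / 4 ^ k

/-- `b_j = ∑_{i=0}^{j} α^(j-i) γ(j-i) γ(i) β^i`. -/
def sqrtCoeff (α β : ℝ) (j : ℕ) : ℝ :=
  ∑ i ∈ Finset.range (j + 1), α ^ (j - i) * gammaCoeff (j - i) * gammaCoeff i * β ^ i

/-- The square root `B` of the counting matrix: lower-triangular Toeplitz with
subdiagonals `b_0, b_1, …`. -/
def sqrtCountingMatrix (α β : ℝ) (n : ℕ) : Matrix (Fin n) (Fin n) ℝ :=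
  Matrix.of fun i j => if j ≤ i then sqrtCoeff α β ((i : ℕ) - (j : ℕ)) else 0

/-! ### Factorization mechanisms and their error -/

/-- `C_{ε,δ} = 2 ln(1.25 / δ) / ε²`. -/
def gaussianMechConst (ε δ : ℝ) : ℝ := 2 * Real.log (1.25 / δ) / ε ^ 2

/-- Neighbouring streams: elements of `{0,1}^n` that differ at exactly one coordinate. -/
def Neighboring {n : ℕ} (x x' : Fin n → ℝ) : Prop :=
  (∀ i, x i = 0 ∨ x i = 1) ∧ (∀ i, x' i = 0 ∨ x' i = 1) ∧ ∃! i, x i ≠ x' i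

/-- The `ℓ₂`-sensitivity of `x ↦ R x`. -/
def sensitivity {m n : ℕ} (R : Matrix (Fin m) (Fin n) ℝ) : ℝ :=
  sSup {d : ℝ | ∃ x x' : Fin n → ℝ, Neighboring x x' ∧
    d = ‖(WithLp.toLp 2 (R *ᵥ (x - x')) : EuclideanSpace ℝ (Fin m))‖}

/-- The law of the noise vector `z ∼ N(0, C_{ε,δ} Δ²)^m`, with `Δ` the sensitivity of `R`. -/
def noiseLaw (ε δ : ℝ) {m n : ℕ} (R : Matrix (Fin m) (Fin n) ℝ) : Measure (Fin m → ℝ) :=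
  Measure.pi fun _ => gaussianReal 0 (gaussianMechConst ε δ * sensitivity R ^ 2).toNNReal

/-- The mean squared error `n⁻¹ E ‖M(x) - A x‖²` of the mechanism `M(x) = A x + L z`, `A = L R`,
whose error vector is `L z`. -/
def meanSE (ε δ : ℝ) {n m : ℕ} (L : Matrix (Fin n) (Fin m) ℝ) (R : Matrix (Fin m) (Fin n) ℝ) :
    ℝ :=
  1 / (n : ℝ) * ∫ z, ∑ i, ((L *ᵥ z) i) ^ 2 ∂(noiseLaw ε δ R)

/-- The maximum squared error `max_i E (M(x) - A x)_i²` of the same mechanism. -/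
def maxSE (ε δ : ℝ) {n m : ℕ} (L : Matrix (Fin n) (Fin m) ℝ) (R : Matrix (Fin m) (Fin n) ℝ) :
    ℝ :=
  ⨆ i : Fin n, ∫ z, ((L *ᵥ z) i) ^ 2 ∂(noiseLaw ε δ R)

/-! ### Space complexity for streaming -/

/-- There is a linear streaming algorithm with state in `ℝ^q` that outputs `L z`: at step `i` a
linear map sends the current state and `z_i` to the next state and the output `(L z)_i`. -/
def HasLinearStreaming {n : ℕ} (L : Matrix (Fin n) (Fin n) ℝ) (q : ℕ) : Prop :=
  ∃ upd : Fin n → ((Fin q → ℝ) × ℝ) →ₗ[ℝ] ((Fin q → ℝ) × ℝ),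
    ∀ z : Fin n → ℝ, ∃ s : Fin (n + 1) → (Fin q → ℝ),
      s 0 = 0 ∧ ∀ i : Fin n, upd i (s i.castSucc, z i) = (s i.succ, (L *ᵥ z) i)

/-- The smallest `q` for which such an algorithm exists. -/
def spaceComplexity {n : ℕ} (L : Matrix (Fin n) (Fin n) ℝ) : ℕ∞ :=
  ⨅ (q : ℕ) (_ : HasLinearStreaming L q), (q : ℕ∞)

/-! ### Binnings and binned matrices -/

/-- Entries of a matrix at natural-number positions (`0` outside the matrix). -/
def entryAt {n : ℕ} (M : Matrix (Fin n) (Fin n) ℝ) (i j : ℕ) : ℝ :=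
  if h : i < n ∧ j < n then M ⟨i, h.1⟩ ⟨j, h.2⟩ else 0

/-- `C` is a partition of `{0, …, i}` into intervals; the pair `(a, b)` stands for `[a, b]`. -/
def IsIntervalPartition (C : Finset (ℕ × ℕ)) (i : ℕ) : Prop :=
  (∀ I ∈ C, I.1 ≤ I.2) ∧
  C.biUnion (fun I => Finset.Icc I.1 I.2) = Finset.Icc 0 i ∧
  ∀ I ∈ C, ∀ J ∈ C, I ≠ J → Disjoint (Finset.Icc I.1 I.2) (Finset.Icc J.1 J.2)

/-- A binning: one partition per row, each interval being contained in an interval of the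
next row. -/
def IsBinning {n : ℕ} (P : Fin n → Finset (ℕ × ℕ)) : Prop :=
  (∀ i, IsIntervalPartition (P i) i) ∧
  ∀ i i' : Fin n, (i' : ℕ) = (i : ℕ) + 1 →
    ∀ I ∈ P i, ∃ I' ∈ P i', Finset.Icc I.1 I.2 ⊆ Finset.Icc I'.1 I'.2

/-- The size of a binning: the largest number of intervals in one of its partitions. -/
def binningSize {n : ℕ} (P : Fin n → Finset (ℕ × ℕ)) : ℕ :=
  Finset.univ.sup fun i => (P i).card

/-- `M` is a `P`-binned matrix: lower-triangular, and constant on each interval in each row. -/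
def IsBinned {n : ℕ} (P : Fin n → Finset (ℕ × ℕ)) (M : Matrix (Fin n) (Fin n) ℝ) : Prop :=
  M.BlockTriangular OrderDual.toDual ∧
  ∀ i : Fin n, ∀ I ∈ P i, ∀ j j' : Fin n,
    (j : ℕ) ∈ Finset.Icc I.1 I.2 → (j' : ℕ) ∈ Finset.Icc I.1 I.2 → M i j = M i j'

/-- `Lhat` is the `P`-approximation of `L`: the `P`-binned matrix whose value on the interval
`[a, b]` of row `i` is `(L_{i,a} + L_{i,b}) / 2`. -/
def IsBinApprox {n : ℕ} (P : Fin n → Finset (ℕ × ℕ)) (L Lhat : Matrix (Fin n) (Fin n) ℝ) :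
    Prop :=
  IsBinned P Lhat ∧
  ∀ i j : Fin n, j ≤ i → ∀ I ∈ P i, (j : ℕ) ∈ Finset.Icc I.1 I.2 →
    Lhat i j = (entryAt L i I.1 + entryAt L i I.2) / 2

/-! ### The binning procedure

The partition of a row is kept as a list of intervals from right to left, the order in which
the procedure visits them. -/

/-- The inner loop: the interval `[a, b]` absorbs the intervals on its left, one after the other,
as long as `row a' / row (b+1) ≥ c²` for the left end point `a'` of the next one. Returned are
the final left end point and the intervals that remain. -/
def absorb (row : ℕ → ℝ) (c : ℝ) (b : ℕ) : ℕ → List (ℕ × ℕ) → ℕ × List (ℕ × ℕ)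
  | a, [] => (a, [])
  | a, I :: rest =>
      if c ^ 2 ≤ row I.1 / row (b + 1) then absorb row c b I.1 rest else (a, I :: rest)

theorem absorb_length_le (row : ℕ → ℝ) (c : ℝ) (b : ℕ) (l : List (ℕ × ℕ)) :
    ∀ a : ℕ, (absorb row c b a l).2.length ≤ l.length := by
  induction l with
  | nil => intro a; simp [absorb]
  | cons I rest ih =>
      intro a
      unfold absorb
      split
      · exact (ih I.1).trans (by simp)
      · simp

/-- The body of the outer loop up to the threshold test: the left end point of the candidate
interval that starts from `[a, b]`, and the intervals that remain to its left. -/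
def candidate (row : ℕ → ℝ) (c : ℝ) (a b : ℕ) (rest : List (ℕ × ℕ)) : ℕ × List (ℕ × ℕ) :=
  if rest ≠ [] ∧ 0 < row (b + 1) ∧ c < row a / row (b + 1) then absorb row c b a rest
  else (a, rest)

theorem candidate_length_le (row : ℕ → ℝ) (c : ℝ) (a b : ℕ) (rest : List (ℕ × ℕ)) :
    (candidate row c a b rest).2.length ≤ rest.length := by
  unfold candidate
  split
  · exact absorb_length_le row c b rest a
  · exact le_rfl

/-- The outer loop over the partition of the previous row, with `row` the current row. -/
def mergePass (row : ℕ → ℝ) (c τ : ℝ) : List (ℕ × ℕ) → List (ℕ × ℕ)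
  | [] => []
  | I :: rest =>
      if row I.2 ≤ τ then [(0, I.2)]
      else ((candidate row c I.1 I.2 rest).1, I.2) ::
        mergePass row c τ (candidate row c I.1 I.2 rest).2
termination_by l => l.length
decreasing_by
  exact Nat.lt_succ_of_le (candidate_length_le row c I.1 I.2 rest)

/-- The partition produced for row `i`. -/
def binRow (L : ℕ → ℕ → ℝ) (c τ : ℝ) : ℕ → List (ℕ × ℕ)
  | 0 => [(0, 0)]
  | i + 1 => (i + 1, i + 1) :: mergePass (L (i + 1)) c τ (binRow L c τ i)

/-- The output of the binning procedure on the matrix `L` with parameters `c` and `τ`. -/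
def binningOf {n : ℕ} (L : Matrix (Fin n) (Fin n) ℝ) (c τ : ℝ) : Fin n → Finset (ℕ × ℕ) :=
  fun i => (binRow (entryAt L) c τ i).toFinset

/-! ### A real RAM with random access to a matrix

The memory consists of integer registers, real registers, integer arrays and real arrays. All
elementary operations cost one unit of time: arithmetic and comparison of reals, incrementing,
decrementing and comparing integers, accessing a register or an array cell, and reading an entry
of the matrix. A program is a finite text. -/

namespace RealRAM

/-- The contents of the memory. -/
structure Memory where
  idx : ℕ → ℕ
  num : ℕ → ℝ
  idxArr : ℕ → ℕ → ℕ
  numArr : ℕ → ℕ → ℝ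

/-- Integer expressions. -/
inductive IdxExpr where
  | lit (k : ℕ)
  | reg (x : ℕ)
  | succ (e : IdxExpr)
  | pred (e : IdxExpr)
  | read (arr : ℕ) (e : IdxExpr)

/-- Real expressions; `entry i j` reads an entry of the matrix. -/
inductive NumExpr where
  | lit (k : ℕ)
  | reg (x : ℕ)
  | add (e f : NumExpr)
  | sub (e f : NumExpr)
  | mul (e f : NumExpr)
  | div (e f : NumExpr)
  | read (arr : ℕ) (e : IdxExpr)
  | entry (i j : IdxExpr)

/-- Tests. -/
inductive Test where
  | idxLt (e f : IdxExpr)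
  | numLt (e f : NumExpr)
  | not (t : Test)
  | and (t u : Test)

/-- Programs. -/
inductive Prog where
  | skip
  | setIdx (x : ℕ) (e : IdxExpr)
  | setNum (x : ℕ) (e : NumExpr)
  | writeIdx (arr : ℕ) (pos val : IdxExpr)
  | writeNum (arr : ℕ) (pos : IdxExpr) (val : NumExpr)
  | seq (p q : Prog)
  | ite (t : Test) (p q : Prog)
  | loop (t : Test) (p : Prog)

/-- The value of an integer expression. -/
def IdxExpr.val (m : Memory) : IdxExpr → ℕ
  | .lit k => k
  | .reg x => m.idx x
  | .succ e => e.val m + 1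
  | .pred e => e.val m - 1
  | .read arr e => m.idxArr arr (e.val m)

/-- The number of elementary operations in the evaluation of an integer expression. -/
def IdxExpr.cost : IdxExpr → ℕ
  | .lit _ => 1
  | .reg _ => 1
  | .succ e => e.cost + 1
  | .pred e => e.cost + 1
  | .read _ e => e.cost + 1

/-- The value of a real expression, the matrix being `M`. -/
def NumExpr.val (M : ℕ → ℕ → ℝ) (m : Memory) : NumExpr → ℝ
  | .lit k => k
  | .reg x => m.num x
  | .add e f => e.val M m + f.val M m
  | .sub e f => e.val M m - f.val M m
  | .mul e f => e.val M m * f.val M m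
  | .div e f => e.val M m / f.val M m
  | .read arr e => m.numArr arr (e.val m)
  | .entry i j => M (i.val m) (j.val m)

/-- The number of elementary operations in the evaluation of a real expression. -/
def NumExpr.cost : NumExpr → ℕ
  | .lit _ => 1
  | .reg _ => 1
  | .add e f => e.cost + f.cost + 1
  | .sub e f => e.cost + f.cost + 1
  | .mul e f => e.cost + f.cost + 1
  | .div e f => e.cost + f.cost + 1
  | .read _ e => e.cost + 1
  | .entry i j => i.cost + j.cost + 1

/-- The outcome of a test. -/
def Test.Holds (M : ℕ → ℕ → ℝ) (m : Memory) : Test → Prop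
  | .idxLt e f => e.val m < f.val m
  | .numLt e f => e.val M m < f.val M m
  | .not t => ¬ t.Holds M m
  | .and t u => t.Holds M m ∧ u.Holds M m

/-- The number of elementary operations in a test. -/
def Test.cost : Test → ℕ
  | .idxLt e f => e.cost + f.cost + 1
  | .numLt e f => e.cost + f.cost + 1
  | .not t => t.cost + 1
  | .and t u => t.cost + u.cost + 1

/-- `Exec M p m t m'`: with random access to `M`, the program `p` started in the memory `m` halts
in the memory `m'` after `t` units of time. -/
inductive Exec (M : ℕ → ℕ → ℝ) : Prog → Memory → ℕ → Memory → Prop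
  | skip (m : Memory) : Exec M .skip m 1 m
  | setIdx (x : ℕ) (e : IdxExpr) (m : Memory) :
      Exec M (.setIdx x e) m (e.cost + 1) { m with idx := Function.update m.idx x (e.val m) }
  | setNum (x : ℕ) (e : NumExpr) (m : Memory) :
      Exec M (.setNum x e) m (e.cost + 1) { m with num := Function.update m.num x (e.val M m) }
  | writeIdx (arr : ℕ) (pos val : IdxExpr) (m : Memory) :
      Exec M (.writeIdx arr pos val) m (pos.cost + val.cost + 1)
        { m with idxArr := Function.update m.idxArr arr
                   (Function.update (m.idxArr arr) (pos.val m) (val.val m)) }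
  | writeNum (arr : ℕ) (pos : IdxExpr) (val : NumExpr) (m : Memory) :
      Exec M (.writeNum arr pos val) m (pos.cost + val.cost + 1)
        { m with numArr := Function.update m.numArr arr
                   (Function.update (m.numArr arr) (pos.val m) (val.val M m)) }
  | seq {p q : Prog} {m m' m'' : Memory} {t t' : ℕ} :
      Exec M p m t m' → Exec M q m' t' m'' → Exec M (.seq p q) m (t + t') m''
  | iteTrue {b : Test} {p q : Prog} {m m' : Memory} {t : ℕ} :
      b.Holds M m → Exec M p m t m' → Exec M (.ite b p q) m (b.cost + t) m'
  | iteFalse {b : Test} {p q : Prog} {m m' : Memory} {t : ℕ} :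
      ¬ b.Holds M m → Exec M q m t m' → Exec M (.ite b p q) m (b.cost + t) m'
  | loopDone {b : Test} {p : Prog} {m : Memory} :
      ¬ b.Holds M m → Exec M (.loop b p) m b.cost m
  | loopStep {b : Test} {p : Prog} {m m' m'' : Memory} {t t' : ℕ} :
      b.Holds M m → Exec M p m t m' → Exec M (.loop b p) m' t' m'' →
      Exec M (.loop b p) m (b.cost + t + t') m''

/-- The memory before the first input: the parameters `c` and `τ` are in the real registers
`1` and `2`, everything else is `0`. -/
def start (c τ : ℝ) : Memory where
  idx := fun _ => 0
  num := Function.update (Function.update (fun _ => 0) 1 c) 2 τ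
  idxArr := fun _ _ => 0
  numArr := fun _ _ => 0

/-- The arrival of an input: it is put into the real register `0`. -/
def feed (m : Memory) (x : ℝ) : Memory := { m with num := Function.update m.num 0 x }

/-- Given random access to `L` and the parameters `c`, `τ`, the program `p`, run once upon the
arrival of each `z_i`, computes `Lhat z` row by row: after its `i`-th run, `(Lhat z)_i` is in the
real register `3`, and each run takes at most `T` units of time. -/
def ComputesOnline (p : Prog) {n : ℕ} (L : Matrix (Fin n) (Fin n) ℝ) (c τ : ℝ)
    (Lhat : Matrix (Fin n) (Fin n) ℝ) (z : Fin n → ℝ) (T : ℕ) : Prop :=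
  ∃ s : Fin (n + 1) → Memory, s 0 = start c τ ∧
    ∀ i : Fin n,
      (∃ t ≤ T, Exec (entryAt L) p (feed (s i.castSucc) (z i)) t (s i.succ)) ∧
      (s i.succ).num 3 = (Lhat *ᵥ z) i

end RealRAM

end

open MeasureTheory ProbabilityTheory Matrix

noncomputable section

/-! ### The coefficients of the square root -/

/-! Write `B` for the square root matrix, `b_k` for its subdiagonals, `S` for the sum of the `b_k`
with `k < n`, and `M` for the binned approximation. Both errors are built from the same row terms: a
constant times the squared sensitivity of the right factor times a squared row norm of the left
factor. So it suffices to compare the rows of `M` with those of `B`, and the norm of `M⁻¹ B² y` with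
that of `B y`.

The `b_k` are positive, decreasing and log-convex (`sqrtCoeff_growth`), by a three-term recursion
read off the generating function `((1 - αX)(1 - βX))^(-1/2)`. By log-convexity, the ratio of the
entries at the two ends of an interval only moves towards 1 in later rows. Hence every interval,
once formed, remains flat up to a factor `c²` or stays below `τ`, and the entries of `B - M` are at
most `4 (1 - c) b_{i-j} + τ` (`abs_sub_binApprox_le`). With `c = 1 - κ/S` and `τ = κ/n` these bounds
add up to `5κ`, so `B - M` has operator norm at most `5κ` by Young's inequality. The inverse of `B`
is Toeplitz with series `(1 - αX)^(1/2) (1 - βX)^(1/2)` and has norm at most `4`. For `v = B y` and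
`w = M⁻¹ B² y` the identity `B (w - v) = (B - M) w` then gives `‖w‖ ≤ (1 - 20κ)⁻¹ ‖v‖`
(`l2norm_right_factor_le`). The choice `κ = ξ/200` yields the factor `1 + ξ`.

For the size, every two intervals produced in a row lower its entries by a factor `c` at least, so a
row has at most `2k + 2` intervals once `c^k ≤ τ` (`mergePass_length_le`), and `k` of order `(S/κ)
log (n/κ)` suffices. Here `S` is bounded if `α < 1`, and of order `√n` if `α = 1`, since `S²` is at
most the sum of the first `2n` subdiagonals of `B²`.

For space and time, each right end in a row is a right end in the previous row or the new index.
Prefix sums up to right ends are therefore a sufficient state, and a pass that rewrites the stored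
intervals in place handles each of them a bounded number of times. -/

theorem gammaCoeff_zero : gammaCoeff 0 = 1 := by simp [gammaCoeff]

theorem gammaCoeff_pos (k : ℕ) : 0 < gammaCoeff k := by
  unfold gammaCoeff
  have := Nat.centralBinom_pos k
  positivity

theorem gammaCoeff_succ (k : ℕ) :
    2 * ((k : ℝ) + 1) * gammaCoeff (k + 1) = (2 * k + 1) * gammaCoeff k := by
  have h := Nat.succ_mul_centralBinom_succ k
  have h' : ((k : ℝ) + 1) * (Nat.centralBinom (k + 1) : ℝ)
      = 2 * (2 * k + 1) * (Nat.centralBinom k : ℝ) := by exact_mod_cast h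
  unfold gammaCoeff
  rw [pow_succ]
  field_simp
  linarith

theorem gammaCoeff_succ_le (k : ℕ) : gammaCoeff (k + 1) ≤ gammaCoeff k := by
  have h := gammaCoeff_succ k
  have h1 := gammaCoeff_pos k
  have hk : (0 : ℝ) ≤ k := k.cast_nonneg
  nlinarith

/-- The generating function of `gammaCoeff`, that is `(1 - X)^(-1/2)`. -/
def gammaSeries : PowerSeries ℝ := PowerSeries.mk gammaCoeff

open PowerSeries in
theorem gammaSeries_derivative :
    2 * d⁄dX ℝ gammaSeries * (1 - X) = gammaSeries := by
  ext n
  have : 2 * d⁄dX ℝ gammaSeries * (1 - X)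
      = C 2 * d⁄dX ℝ gammaSeries - C 2 * (d⁄dX ℝ gammaSeries * X) := by
    rw [map_ofNat]; ring
  rw [this, map_sub, coeff_C_mul, coeff_C_mul, coeff_derivative]
  simp only [gammaSeries, coeff_mk]
  cases n with
  | zero =>
      have := gammaCoeff_succ 0
      simp at this ⊢
      linarith
  | succ n =>
      have := gammaCoeff_succ (n + 1)
      rw [coeff_succ_mul_X, coeff_derivative, coeff_mk]
      push_cast at this ⊢
      linarith

open PowerSeries in
-- The differential equation makes the derivative of the left side vanish, so only the constant
-- coefficients remain to be compared.
theorem gammaSeries_sq : gammaSeries ^ 2 * (1 - X) = 1 := by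
  apply derivative.ext
  · have h := gammaSeries_derivative
    have h1 : d⁄dX ℝ (gammaSeries ^ 2 * (1 - X))
        = gammaSeries * (2 * d⁄dX ℝ gammaSeries * (1 - X)) - gammaSeries ^ 2 := by
      simp only [Derivation.leibniz, Derivation.leibniz_pow, map_sub, derivative_X,
        derivative_one, smul_eq_mul, nsmul_eq_mul]
      push_cast
      ring
    rw [h1, h, derivative_one]
    ring
  · simp [gammaSeries, gammaCoeff_zero]

/-- The generating function of `sqrtCoeff α β`. -/
def sqrtSeries (α β : ℝ) : PowerSeries ℝ := PowerSeries.mk (sqrtCoeff α β)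

open PowerSeries in
theorem sqrtSeries_eq (α β : ℝ) :
    sqrtSeries α β = rescale α gammaSeries * rescale β gammaSeries := by
  ext n
  rw [mul_comm, coeff_mul, Finset.Nat.sum_antidiagonal_eq_sum_range_succ_mk]
  simp only [sqrtSeries, sqrtCoeff, gammaSeries, coeff_rescale, coeff_mk]
  exact Finset.sum_congr rfl fun i _ => by ring

open PowerSeries in
theorem rescale_gammaSeries_sq (a : ℝ) :
    rescale a gammaSeries ^ 2 * (1 - C a * X) = 1 := by
  have h := congrArg (rescale a) gammaSeries_sq
  simpa [rescale_X] using h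

open PowerSeries in
theorem sqrtSeries_sq (α β : ℝ) :
    sqrtSeries α β ^ 2 * ((1 - C α * X) * (1 - C β * X)) = 1 := by
  calc _ = (rescale α gammaSeries ^ 2 * (1 - C α * X)) *
        (rescale β gammaSeries ^ 2 * (1 - C β * X)) := by rw [sqrtSeries_eq]; ring
    _ = 1 := by rw [rescale_gammaSeries_sq, rescale_gammaSeries_sq, one_mul]

open PowerSeries in
theorem sqrtSeries_sq_eq (α β : ℝ) (h : α ≠ β) :
    sqrtSeries α β * sqrtSeries α β =
      mk fun k => (α ^ (k + 1) - β ^ (k + 1)) / (α - β) := by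
  have hab : α - β ≠ 0 := sub_ne_zero.2 h
  have h1 : (mk fun k => (α ^ (k + 1) - β ^ (k + 1)) / (α - β)) *
      ((1 - C α * X) * (1 - C β * X)) = 1 := by
    have e : ((1 - C α * X) * (1 - C β * X) : PowerSeries ℝ)
        = 1 - C (α + β) * X + C (α * β) * X * X := by
      rw [map_add, map_mul]; ring
    rw [e]
    set f : PowerSeries ℝ := mk fun k => (α ^ (k + 1) - β ^ (k + 1)) / (α - β) with hf
    have e2 : f * (1 - C (α + β) * X + C (α * β) * X * X)
        = f - C (α + β) * (f * X) + C (α * β) * (f * X * X) := by ring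
    rw [e2]
    ext n
    rw [map_add, map_sub, coeff_C_mul, coeff_C_mul]
    match n with
    | 0 => simp [hf, hab]
    | 1 =>
        simp only [coeff_succ_mul_X, coeff_zero_mul_X, coeff_one, hf, coeff_mk]
        simp
        field_simp
        ring
    | n + 2 =>
        simp only [coeff_succ_mul_X, coeff_one, hf, coeff_mk]
        simp
        field_simp
        ring
  have hne : ((1 - C α * X) * (1 - C β * X) : PowerSeries ℝ) ≠ 0 := by
    intro h0
    rw [h0, mul_zero] at h1
    exact zero_ne_one h1
  apply mul_right_cancel₀ hne
  rw [h1, ← sq, sqrtSeries_sq]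

theorem sqrtCoeff_zero (α β : ℝ) : sqrtCoeff α β 0 = 1 := by
  simp [sqrtCoeff, gammaCoeff_zero]

open PowerSeries in
-- Differentiate `F² D = 1` for `D = (1 - αX)(1 - βX)` and cancel one factor `F`.
theorem sqrtSeries_derivative (α β : ℝ) :
    2 * d⁄dX ℝ (sqrtSeries α β) * ((1 - C α * X) * (1 - C β * X)) =
      sqrtSeries α β * (C α * (1 - C β * X) + C β * (1 - C α * X)) := by
  have h := sqrtSeries_sq α β
  have hne : sqrtSeries α β ≠ 0 := by
    intro h0
    rw [h0] at h
    simp at h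
  have h1 := congrArg (d⁄dX ℝ) h
  simp only [Derivation.leibniz, Derivation.leibniz_pow, map_sub, derivative_X, derivative_C,
        derivative_one, smul_eq_mul, nsmul_eq_mul] at h1
  apply mul_left_cancel₀ hne
  push_cast at h1
  linear_combination h1

open PowerSeries in
theorem sqrtCoeff_rec (α β : ℝ) (j : ℕ) :
    ((j : ℝ) + 2) * sqrtCoeff α β (j + 2) =
      (2 * j + 3) * ((α + β) / 2) * sqrtCoeff α β (j + 1)
        - (j + 1) * (α * β) * sqrtCoeff α β j := by
  have h := sqrtSeries_derivative α β
  set f := sqrtSeries α β with hf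
  have e1 : 2 * d⁄dX ℝ f * ((1 - C α * X) * (1 - C β * X))
      = C 2 * d⁄dX ℝ f - C (2 * (α + β)) * (d⁄dX ℝ f * X)
        + C (2 * (α * β)) * (d⁄dX ℝ f * X * X) := by
    simp only [map_mul, map_add, map_ofNat]; ring
  have e2 : f * (C α * (1 - C β * X) + C β * (1 - C α * X))
      = C (α + β) * f - C (2 * (α * β)) * (f * X) := by
    simp only [map_mul, map_add, map_ofNat]; ring
  rw [e1, e2] at h
  have h1 := congrArg (coeff (j + 1)) h
  rw [map_add, map_sub, map_sub, coeff_C_mul, coeff_C_mul, coeff_C_mul, coeff_C_mul, coeff_C_mul,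
    coeff_succ_mul_X, coeff_succ_mul_X, coeff_succ_mul_X, coeff_derivative, coeff_derivative] at h1
  have e3 : coeff j (d⁄dX ℝ f * X) = j * coeff j f := by
    cases j with
    | zero => simp
    | succ j => rw [coeff_succ_mul_X, coeff_derivative]; push_cast; ring
  rw [e3] at h1
  simp only [hf, sqrtSeries, coeff_mk] at h1
  push_cast at h1
  rw [show j + 1 + 1 = j + 2 from rfl] at h1
  linarith

theorem sqrtCoeff_one (α β : ℝ) : sqrtCoeff α β 1 = (α + β) / 2 := by
  have h := gammaCoeff_succ 0
  rw [gammaCoeff_zero] at h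
  simp at h
  have h1 : gammaCoeff 1 = 1 / 2 := by linarith
  simp [sqrtCoeff, Finset.sum_range_succ, gammaCoeff_zero, h1]
  ring

/-- Positivity, log-convexity, and the bounds `(α + β) / 2 ≤ b_{j+1} / b_j ≤ α`. -/
theorem sqrtCoeff_growth {α β : ℝ} (hβ : 0 ≤ β) (hαβ : β < α) (j : ℕ) :
    0 < sqrtCoeff α β j ∧ 0 < sqrtCoeff α β (j + 1) ∧
    (α + β) / 2 * sqrtCoeff α β j ≤ sqrtCoeff α β (j + 1) ∧
    sqrtCoeff α β (j + 1) ≤ α * sqrtCoeff α β j ∧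
    sqrtCoeff α β (j + 1) * sqrtCoeff α β (j + 1) ≤
      sqrtCoeff α β j * sqrtCoeff α β (j + 2) := by
  set s := (α + β) / 2 with hs
  have hs0 : 0 < s := by rw [hs]; linarith
  have hα : 0 < α := by linarith
  have hsp : α * β ≤ s * s := by rw [hs]; nlinarith [sq_nonneg (α - β)]
  -- The claims need a joint induction: the lower ratio bound follows from log-convexity one step
  -- earlier, and log-convexity from the ratio bounds.
  induction j with
  | zero =>
      have h := sqrtCoeff_rec α β 0
      simp only [zero_add, sqrtCoeff_zero, sqrtCoeff_one, ← hs, Nat.cast_zero] at h ⊢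
      refine ⟨one_pos, hs0, by linarith, by rw [hs]; linarith, ?_⟩
      nlinarith
  | succ j ih =>
      obtain ⟨h0, h1, h2, h3, h4⟩ := ih
      have r1 := sqrtCoeff_rec α β j
      have r2 := sqrtCoeff_rec α β (j + 1)
      rw [← hs] at r1 r2
      push_cast at r2
      simp only [add_assoc, Nat.reduceAdd] at r2 ⊢
      norm_num at r2
      set x := sqrtCoeff α β j
      set y := sqrtCoeff α β (j + 1)
      set w := sqrtCoeff α β (j + 2)
      set v := sqrtCoeff α β (j + 3)
      have hj : (0 : ℝ) ≤ j := j.cast_nonneg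
      have hsw : s * y ≤ w := by
        have : s * y * x ≤ w * x := by nlinarith
        exact le_of_mul_le_mul_right this h0
      have hw : 0 < w := lt_of_lt_of_le (by positivity) hsw
      have hyα : β * y ≤ α * β * x := by nlinarith
      have hwα : w ≤ α * y := by
        have : ((j : ℝ) + 2) * w ≤ (j + 2) * (α * y) := by
          have e : (2 * (j : ℝ) + 3) * s * y = (j + 1) * (α * y) + (j + 1) * (β * y) + s * y := by
            rw [hs]; ring
          have : s * y ≤ α * y := by
            apply mul_le_mul_of_nonneg_right _ h1.le
            rw [hs]; linarith
          nlinarith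
        exact le_of_mul_le_mul_left this (by positivity)
      refine ⟨h1, hw, hsw, hwα, ?_⟩
      -- `(j+3) y v = (2j+5) s y w - (j+2) p y²`, `(j+2) w² = (2j+3) s y w - (j+1) p x w`
      have hpx : α * β * x ≤ s * y := by nlinarith
      -- With `p = αβ`, right side minus left side is `(s y - p x) w + (j+2)² p (x w - y²)`, because
      -- `(j+2)(2j+5) - (j+3)(2j+3) = 1` and `(j+1)(j+3) = (j+2)² - 1`.
      have key : ((j : ℝ) + 2) * (j + 3) * (w * w) ≤ ((j : ℝ) + 2) * (j + 3) * (y * v) := by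
        have a1 : ((j : ℝ) + 2) * (j + 3) * (y * v)
            = (j + 2) * y * ((2 * j + 5) * s * w - (j + 2) * (α * β) * y) := by
          rw [show ((j : ℝ) + 2) * (j + 3) * (y * v) = (j + 2) * y * ((j + 3) * v) by ring]
          congr 1
          linarith
        have a2 : ((j : ℝ) + 2) * (j + 3) * (w * w)
            = (j + 3) * w * ((2 * j + 3) * s * y - (j + 1) * (α * β) * x) := by
          rw [← r1]; ring
        have b1 : (α * β) * (y * y) ≤ (α * β) * (x * w) :=
          mul_le_mul_of_nonneg_left h4 (by positivity)
        have b2 : (α * β * x) * w ≤ s * y * w := mul_le_mul_of_nonneg_right hpx hw.le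
        rw [a1, a2]
        have b3 : ((j : ℝ) + 2) * (j + 2) * ((α * β) * (y * y))
            ≤ (j + 2) * (j + 2) * ((α * β) * (x * w)) :=
          mul_le_mul_of_nonneg_left b1 (by positivity)
        linarith
      exact le_of_mul_le_mul_left key (by positivity)

/-! ### Decay, log-convexity and partial sums of the coefficients. -/

section coeffs

variable {α β : ℝ}

theorem sqrtCoeff_pos (hβ : 0 ≤ β) (hαβ : β < α) (j : ℕ) : 0 < sqrtCoeff α β j :=
  (sqrtCoeff_growth hβ hαβ j).1

theorem sqrtCoeff_succ_le (hβ : 0 ≤ β) (hαβ : β < α) (j : ℕ) :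
    sqrtCoeff α β (j + 1) ≤ α * sqrtCoeff α β j :=
  (sqrtCoeff_growth hβ hαβ j).2.2.2.1

theorem sqrtCoeff_antitone (hβ : 0 ≤ β) (hαβ : β < α) (hα : α ≤ 1) :
    Antitone (sqrtCoeff α β) := by
  apply antitone_nat_of_succ_le
  intro j
  have h1 := sqrtCoeff_succ_le hβ hαβ j
  have h2 := sqrtCoeff_pos hβ hαβ j
  nlinarith

theorem sqrtCoeff_le_pow (hβ : 0 ≤ β) (hαβ : β < α) (j : ℕ) : sqrtCoeff α β j ≤ α ^ j := by
  induction j with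
  | zero => simp [sqrtCoeff_zero]
  | succ j ih =>
      rw [pow_succ']
      exact (sqrtCoeff_succ_le hβ hαβ j).trans
        (mul_le_mul_of_nonneg_left ih (by linarith))

/-- Chains the inequality for neighbours: the ratio of two coefficients at distance `d` grows with
the position. This is what preserves flatness of an interval from one row to the next. -/
theorem sqrtCoeff_logConvex (hβ : 0 ≤ β) (hαβ : β < α) (j d : ℕ) :
    sqrtCoeff α β (j + d) * sqrtCoeff α β (j + 1) ≤
      sqrtCoeff α β j * sqrtCoeff α β (j + d + 1) := by
  induction d with
  | zero => simp
  | succ d ih =>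
      have h := (sqrtCoeff_growth hβ hαβ (j + d)).2.2.2.2
      have p0 := sqrtCoeff_pos hβ hαβ (j + d)
      have p1 := sqrtCoeff_pos hβ hαβ (j + d + 1)
      have q0 := sqrtCoeff_pos hβ hαβ j
      rw [← add_assoc]
      set x := sqrtCoeff α β (j + d)
      set y := sqrtCoeff α β (j + d + 1)
      rw [show j + d + 1 + 1 = j + d + 2 from rfl]
      set w := sqrtCoeff α β (j + d + 2)
      have : x * (y * sqrtCoeff α β (j + 1)) ≤ x * (sqrtCoeff α β j * w) := by
        calc x * (y * sqrtCoeff α β (j + 1)) = y * (x * sqrtCoeff α β (j + 1)) := by ring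
          _ ≤ y * (sqrtCoeff α β j * y) := mul_le_mul_of_nonneg_left ih p1.le
          _ = sqrtCoeff α β j * (y * y) := by ring
          _ ≤ sqrtCoeff α β j * (x * w) := mul_le_mul_of_nonneg_left h q0.le
          _ = _ := by ring
      exact le_of_mul_le_mul_left this p0

theorem sum_sqrtCoeff_le_of_lt_one (hβ : 0 ≤ β) (hαβ : β < α) (hα : α < 1) (n : ℕ) :
    ∑ k ∈ Finset.range n, sqrtCoeff α β k ≤ 1 / (1 - α) := by
  have h0 : 0 ≤ α := by linarith
  calc _ ≤ ∑ k ∈ Finset.range n, α ^ k :=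
        Finset.sum_le_sum fun k _ => sqrtCoeff_le_pow hβ hαβ k
    _ ≤ ∑' k, α ^ k := (summable_geometric_of_lt_one h0 hα).sum_le_tsum _
        fun k _ => by positivity
    _ = _ := by rw [tsum_geometric_of_lt_one h0 hα, one_div]

open PowerSeries in
theorem sum_antidiagonal_sqrtCoeff (h : α ≠ β) (k : ℕ) :
    ∑ x ∈ Finset.HasAntidiagonal.antidiagonal k, sqrtCoeff α β x.1 * sqrtCoeff α β x.2 =
      (α ^ (k + 1) - β ^ (k + 1)) / (α - β) := by
  have := congrArg (coeff k) (sqrtSeries_sq_eq α β h)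
  rw [coeff_mul, coeff_mk] at this
  simpa [sqrtSeries] using this

/-- Expanding the square and grouping the products by index sum gives parts of the convolution of
`b` with itself, which is the sequence of subdiagonals of the counting matrix; each of these is at
most `1 / (1 - β)`. -/
theorem sum_sqrtCoeff_sq_le (hβ : 0 ≤ β) (hβ1 : β < 1) (n : ℕ) :
    (∑ k ∈ Finset.range n, sqrtCoeff 1 β k) ^ 2 ≤ 2 * n / (1 - β) := by
  have hp := fun k => (sqrtCoeff_pos hβ hβ1 k).le
  rw [sq, Finset.sum_mul_sum, ← Finset.sum_product']
  rw [← Finset.sum_fiberwise_of_maps_to (s := Finset.range n ×ˢ Finset.range n)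
    (t := Finset.range (2 * n)) (g := fun x => x.1 + x.2)]
  swap
  · intro x hx
    simp only [Finset.mem_product, Finset.mem_range] at hx ⊢
    omega
  calc _ ≤ ∑ k ∈ Finset.range (2 * n), (1 ^ (k + 1) - β ^ (k + 1)) / (1 - β) := by
        refine Finset.sum_le_sum fun k _ => ?_
        rw [← sum_antidiagonal_sqrtCoeff hβ1.ne' k]
        refine Finset.sum_le_sum_of_subset_of_nonneg ?_ fun x _ _ => mul_nonneg (hp _) (hp _)
        intro x hx
        exact Finset.HasAntidiagonal.mem_antidiagonal.2 (Finset.mem_filter.1 hx).2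
    _ ≤ ∑ k ∈ Finset.range (2 * n), 1 / (1 - β) := by
        refine Finset.sum_le_sum fun k _ => ?_
        have : 0 ≤ β ^ (k + 1) := by positivity
        rw [one_pow]
        exact div_le_div_of_nonneg_right (by linarith) (by linarith)
    _ = _ := by simp; ring

end coeffs

/-! ### Lower-triangular Toeplitz matrices -/

/-- The lower-triangular Toeplitz matrix of a power series. -/
def toep (n : ℕ) (f : PowerSeries ℝ) : Matrix (Fin n) (Fin n) ℝ :=
  Matrix.of fun i j => if j ≤ i then PowerSeries.coeff ((i : ℕ) - j) f else 0

open PowerSeries in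
-- Makes identities between power series available for matrices, in particular for the square and
-- the inverse of the square root.
theorem toep_mul (n : ℕ) (f g : PowerSeries ℝ) : toep n (f * g) = toep n f * toep n g := by
  ext i k
  simp only [toep, Matrix.of_apply, Matrix.mul_apply]
  split_ifs with h
  · have h' : (k : ℕ) ≤ i := h
    rw [mul_comm f g, coeff_mul]
    simp only [ite_mul, mul_ite, zero_mul, mul_zero]
    rw [← Finset.sum_filter, ← Finset.sum_filter, Finset.filter_filter]
    refine Finset.sum_bij' (fun x hx => ⟨k + x.1, ?_⟩) (fun j _ => ((j : ℕ) - k, (i : ℕ) - j))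
      ?_ ?_ ?_ ?_ ?_
    · have := Finset.HasAntidiagonal.mem_antidiagonal.1 hx
      have := i.2
      omega
    · intro x hx
      have := Finset.HasAntidiagonal.mem_antidiagonal.1 hx
      simp only [Finset.mem_filter, Finset.mem_univ, true_and, Fin.le_def]
      omega
    · intro j hj
      simp only [Finset.mem_filter, Finset.mem_univ, true_and, Fin.le_def] at hj
      simp only [Finset.HasAntidiagonal.mem_antidiagonal]
      omega
    · rintro ⟨x, y⟩ hx
      have := Finset.HasAntidiagonal.mem_antidiagonal.1 hx
      simp only [Prod.mk.injEq] at this ⊢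
      omega
    · intro j hj
      simp only [Finset.mem_filter, Finset.mem_univ, true_and, Fin.le_def] at hj
      ext
      simp only
      omega
    · rintro ⟨x, y⟩ hx
      have := Finset.HasAntidiagonal.mem_antidiagonal.1 hx
      simp only at this ⊢
      rw [mul_comm, show (i : ℕ) - (k + x) = y by omega, show (k : ℕ) + x - k = x by omega]
  · symm
    refine Finset.sum_eq_zero fun j _ => ?_
    split_ifs with h1 h2 <;> simp
    exact absurd (h2.trans h1) h

theorem toep_one (n : ℕ) : toep n 1 = 1 := by
  ext i j
  simp only [toep, Matrix.of_apply, PowerSeries.coeff_one, Matrix.one_apply, Fin.le_def, Fin.ext_iff]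
  split_ifs <;> first | rfl | omega

theorem sqrtCountingMatrix_eq_toep (α β : ℝ) (n : ℕ) :
    sqrtCountingMatrix α β n = toep n (sqrtSeries α β) := by
  ext i j
  simp [sqrtCountingMatrix, toep, sqrtSeries]

theorem sqrtCountingMatrix_mul_self {α β : ℝ} (h : α ≠ β) (n : ℕ) :
    sqrtCountingMatrix α β n * sqrtCountingMatrix α β n = countingMatrix α β n := by
  rw [sqrtCountingMatrix_eq_toep, ← toep_mul, sqrtSeries_sq_eq α β h]
  ext i j
  simp [toep, countingMatrix]

/-! ### Euclidean norms: Young's inequality and the norm of the inverse square root. -/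

/-- The Euclidean norm of a vector. -/
def l2norm {m : ℕ} (v : Fin m → ℝ) : ℝ := ‖(WithLp.toLp 2 v : EuclideanSpace ℝ (Fin m))‖

section l2norm

variable {m : ℕ} (v w : Fin m → ℝ)

theorem l2norm_nonneg : 0 ≤ l2norm v := norm_nonneg _

theorem l2norm_sq : l2norm v ^ 2 = ∑ i, v i ^ 2 := by
  rw [l2norm, EuclideanSpace.real_norm_sq_eq]

theorem l2norm_add_le : l2norm (v + w) ≤ l2norm v + l2norm w := by
  unfold l2norm
  rw [WithLp.toLp_add]
  exact norm_add_le _ _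

theorem l2norm_le_of_abs_le (h : ∀ i, |v i| ≤ w i) : l2norm v ≤ l2norm w := by
  apply le_of_sq_le_sq _ (l2norm_nonneg w)
  rw [l2norm_sq, l2norm_sq]
  exact Finset.sum_le_sum fun i _ => sq_le_sq' (by linarith [neg_abs_le (v i), h i])
    ((le_abs_self _).trans (h i))

end l2norm

theorem sum_shift_le {e : ℕ → ℝ} (he : ∀ k, 0 ≤ e k) {n : ℕ} (s : Finset (Fin n)) (φ : Fin n → ℕ)
    (hφ : Set.InjOn φ s) (hn : ∀ j ∈ s, φ j < n) :
    ∑ j ∈ s, e (φ j) ≤ ∑ k ∈ Finset.range n, e k := by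
  rw [← Finset.sum_image (f := e) hφ]
  refine Finset.sum_le_sum_of_subset_of_nonneg ?_ fun k _ _ => he k
  intro k hk
  obtain ⟨j, hj, rfl⟩ := Finset.mem_image.1 hk
  exact Finset.mem_range.2 (hn j hj)

/-- Young's inequality for lower-triangular matrices dominated by a Toeplitz matrix. -/
theorem l2norm_mulVec_le {n : ℕ} (M : Matrix (Fin n) (Fin n) ℝ) (e : ℕ → ℝ) (he : ∀ k, 0 ≤ e k)
    (hM : ∀ i j : Fin n, j ≤ i → |M i j| ≤ e ((i : ℕ) - j)) (h0 : ∀ i j : Fin n, i < j → M i j = 0)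
    (x : Fin n → ℝ) :
    l2norm (M *ᵥ x) ≤ (∑ k ∈ Finset.range n, e k) * l2norm x := by
  set S := ∑ k ∈ Finset.range n, e k with hS
  have hS0 : 0 ≤ S := Finset.sum_nonneg fun k _ => he k
  set E : Fin n → Fin n → ℝ := fun i j => if j ≤ i then e ((i : ℕ) - j) else 0 with hE
  have hE0 : ∀ i j, 0 ≤ E i j := fun i j => by
    simp only [hE]; split_ifs; exacts [he _, le_rfl]
  have hME : ∀ i j, |M i j| ≤ E i j := fun i j => by
    simp only [hE]; split_ifs with h
    · exact hM i j h
    · rw [h0 i j (not_le.1 h), abs_zero]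
  have hrow : ∀ i, ∑ j, E i j ≤ S := fun i => by
    simp only [hE]
    rw [← Finset.sum_filter]
    apply sum_shift_le he
    · intro j hj k hk h
      simp only [Finset.coe_filter, Set.mem_ofPred_eq, Finset.mem_univ, true_and, Fin.le_def]
        at hj hk h
      ext; omega
    · intro j _
      have := i.2
      omega
  have hcol : ∀ j, ∑ i, E i j ≤ S := fun j => by
    simp only [hE]
    rw [← Finset.sum_filter]
    apply sum_shift_le he
    · intro i hi k hk h
      simp only [Finset.coe_filter, Set.mem_ofPred_eq, Finset.mem_univ, true_and, Fin.le_def]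
        at hi hk h
      ext; omega
    · intro i _
      have := i.2
      omega
  apply le_of_sq_le_sq _ (mul_nonneg hS0 (l2norm_nonneg x))
  rw [mul_pow, l2norm_sq, l2norm_sq]
  -- Cauchy–Schwarz with the weights `E i j`. The row sums are used here; the column sums enter
  -- after the order of summation is exchanged.
  have hi : ∀ i, (M *ᵥ x) i ^ 2 ≤ S * ∑ j, E i j * x j ^ 2 := fun i => by
    have h1 : |(M *ᵥ x) i| ≤ ∑ j, E i j * |x j| := by
      rw [Matrix.mulVec, dotProduct]
      refine (Finset.abs_sum_le_sum_abs _ _).trans (Finset.sum_le_sum fun j _ => ?_)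
      rw [abs_mul]
      exact mul_le_mul_of_nonneg_right (hME i j) (abs_nonneg _)
    have h2 : (∑ j, E i j * |x j|) ^ 2 ≤ (∑ j, E i j) * ∑ j, E i j * x j ^ 2 := by
      apply Finset.sum_sq_le_sum_mul_sum_of_sq_le_mul
      · intro j _; exact hE0 i j
      · intro j _; exact mul_nonneg (hE0 i j) (sq_nonneg _)
      · intro j _; rw [mul_pow, sq_abs, sq, mul_assoc]
    rw [← sq_abs]
    calc _ ≤ (∑ j, E i j * |x j|) ^ 2 := pow_le_pow_left₀ (abs_nonneg _) h1 2
      _ ≤ _ := h2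
      _ ≤ _ := mul_le_mul_of_nonneg_right (hrow i)
          (Finset.sum_nonneg fun j _ => mul_nonneg (hE0 i j) (sq_nonneg _))
  calc _ ≤ ∑ i, S * ∑ j, E i j * x j ^ 2 := Finset.sum_le_sum fun i _ => hi i
    _ = S * ∑ j, (∑ i, E i j) * x j ^ 2 := by
        rw [← Finset.mul_sum, Finset.sum_comm]
        simp_rw [Finset.sum_mul]
    _ ≤ S * ∑ j, S * x j ^ 2 := by
        apply mul_le_mul_of_nonneg_left _ hS0
        exact Finset.sum_le_sum fun j _ => mul_le_mul_of_nonneg_right (hcol j) (sq_nonneg _)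
    _ = _ := by rw [← Finset.mul_sum]; ring

theorem l2norm_toep_mulVec_le (n : ℕ) (f : PowerSeries ℝ) (x : Fin n → ℝ) :
    l2norm (toep n f *ᵥ x) ≤
      (∑ k ∈ Finset.range n, |PowerSeries.coeff k f|) * l2norm x := by
  apply l2norm_mulVec_le _ _ fun k => abs_nonneg _
  · intro i j h
    simp [toep, h]
  · intro i j h
    simp [toep, not_le.2 h]

open PowerSeries in
/-- The series `(1 - a X)^(1/2)` has absolute coefficient sum at most `2` when `0 ≤ a ≤ 1`. -/
theorem sum_abs_coeff_le_two {a : ℝ} (h0 : 0 ≤ a) (h1 : a ≤ 1) (n : ℕ) :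
    ∑ k ∈ Finset.range n, |coeff k (rescale a gammaSeries * (1 - C a * X))| ≤ 2 := by
  have e : rescale a gammaSeries * (1 - C a * X)
      = rescale a gammaSeries - C a * (rescale a gammaSeries * X) := by ring
  -- All coefficients after the first are nonpositive, and their sizes are dominated by the
  -- telescoping differences of `gammaCoeff`, whose total is at most `1`.
  have hc : ∀ k, |coeff (k + 1) (rescale a gammaSeries * (1 - C a * X))|
      ≤ gammaCoeff k - gammaCoeff (k + 1) := fun k => by
    rw [e, map_sub, coeff_C_mul, coeff_succ_mul_X, coeff_rescale, coeff_rescale, gammaSeries,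
      coeff_mk, coeff_mk, show a ^ (k + 1) * gammaCoeff (k + 1) - a * (a ^ k * gammaCoeff k)
        = - (a ^ (k + 1) * (gammaCoeff k - gammaCoeff (k + 1))) by ring, abs_neg]
    have hd : 0 ≤ gammaCoeff k - gammaCoeff (k + 1) := sub_nonneg.2 (gammaCoeff_succ_le k)
    rw [abs_of_nonneg (by positivity)]
    exact mul_le_of_le_one_left hd (pow_le_one₀ h0 h1)
  cases n with
  | zero => simp
  | succ n =>
      rw [Finset.sum_range_succ']
      have hz : |coeff 0 (rescale a gammaSeries * (1 - C a * X))| = 1 := by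
        rw [e, map_sub, coeff_C_mul, coeff_zero_mul_X, coeff_rescale, gammaSeries, coeff_mk]
        simp [gammaCoeff_zero]
      rw [hz]
      have : ∑ k ∈ Finset.range n, |coeff (k + 1) (rescale a gammaSeries * (1 - C a * X))|
          ≤ gammaCoeff 0 - gammaCoeff n := by
        rw [← Finset.sum_range_sub']
        exact Finset.sum_le_sum fun k _ => hc k
      have := gammaCoeff_pos n
      have := gammaCoeff_zero
      linarith

open PowerSeries in
/-- The square root matrix expands Euclidean norms at least by `1 / 4`. -/
theorem l2norm_le_sqrtCountingMatrix {α β : ℝ} (hβ : 0 ≤ β) (hαβ : β < α) (hα : α ≤ 1) (n : ℕ)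
    (x : Fin n → ℝ) : l2norm x ≤ 4 * l2norm (sqrtCountingMatrix α β n *ᵥ x) := by
  set f := rescale α gammaSeries * (1 - C α * X)
  set g := rescale β gammaSeries * (1 - C β * X)
  -- `f` and `g` are the square roots of the two linear factors, so the inverse of the matrix is a
  -- product of two Toeplitz matrices of norm at most `2`.
  have hfg : f * (g * sqrtSeries α β) = 1 := by
    rw [← sqrtSeries_sq α β, sqrtSeries_eq]
    ring
  have hx : x = toep n f *ᵥ (toep n g *ᵥ (sqrtCountingMatrix α β n *ᵥ x)) := by
    rw [sqrtCountingMatrix_eq_toep, Matrix.mulVec_mulVec, Matrix.mulVec_mulVec, Matrix.mul_assoc,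
      ← toep_mul, ← toep_mul, hfg, toep_one, Matrix.one_mulVec]
  set y := sqrtCountingMatrix α β n *ᵥ x
  have hy := l2norm_nonneg y
  calc l2norm x ≤ 2 * l2norm (toep n g *ᵥ y) := by
        conv_lhs => rw [hx]
        exact (l2norm_toep_mulVec_le n f _).trans (mul_le_mul_of_nonneg_right
          (sum_abs_coeff_le_two (by linarith) hα n) (l2norm_nonneg _))
    _ ≤ 2 * (2 * l2norm y) := by
        apply mul_le_mul_of_nonneg_left _ two_pos.le
        exact (l2norm_toep_mulVec_le n g _).trans (mul_le_mul_of_nonneg_right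
          (sum_abs_coeff_le_two hβ (by linarith) n) hy)
    _ = 4 * l2norm y := by ring

/-! ### The binning procedure -/

/-- The list `l` runs from right to left through a partition of `{0, …, m - 1}` into intervals. -/
def Tiles : ℕ → List (ℕ × ℕ) → Prop
  | m, [] => m = 0
  | m, I :: rest => I.1 ≤ I.2 ∧ I.2 + 1 = m ∧ Tiles I.1 rest

namespace Tiles

theorem bounds {l : List (ℕ × ℕ)} : ∀ {m : ℕ}, Tiles m l → ∀ I ∈ l, I.1 ≤ I.2 ∧ I.2 < m := by
  induction l with
  | nil => simp
  | cons J rest ih =>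
      rintro m ⟨h1, h2, h3⟩ I hI
      rcases List.mem_cons.1 hI with rfl | hI
      · omega
      · have := ih h3 I hI
        omega

theorem exists_mem {l : List (ℕ × ℕ)} :
    ∀ {m : ℕ}, Tiles m l → ∀ j < m, ∃ I ∈ l, I.1 ≤ j ∧ j ≤ I.2 := by
  induction l with
  | nil => intro m h j hj; simp only [Tiles] at h; omega
  | cons J rest ih =>
      rintro m ⟨h1, h2, h3⟩ j hj
      by_cases hJ : J.1 ≤ j
      · exact ⟨J, by simp, hJ, by omega⟩
      · obtain ⟨I, hI, h⟩ := ih h3 j (by omega)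
        exact ⟨I, by simp [hI], h⟩

theorem separated {l : List (ℕ × ℕ)} :
    ∀ {m : ℕ}, Tiles m l → ∀ I ∈ l, ∀ J ∈ l, I ≠ J → I.2 < J.1 ∨ J.2 < I.1 := by
  induction l with
  | nil => simp
  | cons A rest ih =>
      rintro m ⟨h1, h2, h3⟩ I hI J hJ hIJ
      rcases List.mem_cons.1 hI with rfl | hI' <;> rcases List.mem_cons.1 hJ with rfl | hJ'
      · exact absurd rfl hIJ
      · exact Or.inr (bounds h3 J hJ').2
      · exact Or.inl (bounds h3 I hI').2
      · exact ih h3 I hI' J hJ' hIJ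

theorem nodup {l : List (ℕ × ℕ)} : ∀ {m : ℕ}, Tiles m l → l.Nodup := by
  induction l with
  | nil => simp
  | cons A rest ih =>
      rintro m ⟨h1, h2, h3⟩
      refine List.nodup_cons.2 ⟨fun hA => ?_, ih h3⟩
      have := bounds h3 A hA
      omega

/-- Lets the sum over an interval be written as a difference of prefix sums up to right ends. -/
theorem left_eq_zero_or {l : List (ℕ × ℕ)} :
    ∀ {m : ℕ}, Tiles m l → ∀ I ∈ l, I.1 = 0 ∨ ∃ J ∈ l, J.2 + 1 = I.1 := by
  induction l with
  | nil => simp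
  | cons A rest ih =>
      rintro m ⟨h1, h2, h3⟩ I hI
      rcases List.mem_cons.1 hI with rfl | hI
      · cases rest with
        | nil => exact Or.inl h3
        | cons B rest => exact Or.inr ⟨B, by simp, h3.2.1⟩
      · rcases ih h3 I hI with h | ⟨J, hJ, h⟩
        · exact Or.inl h
        · exact Or.inr ⟨J, by simp [hJ], h⟩

theorem isIntervalPartition {l : List (ℕ × ℕ)} {i : ℕ} (h : Tiles (i + 1) l) :
    IsIntervalPartition l.toFinset i := by
  refine ⟨fun I hI => (h.bounds I (List.mem_toFinset.1 hI)).1, ?_, ?_⟩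
  · ext j
    simp only [Finset.mem_biUnion, List.mem_toFinset, Finset.mem_Icc, zero_le, true_and]
    constructor
    · rintro ⟨I, hI, h1, h2⟩
      have := h.bounds I hI
      omega
    · intro hj
      exact h.exists_mem j (by omega)
  · intro I hI J hJ hIJ
    rw [Finset.disjoint_left]
    intro j h1 h2
    rw [Finset.mem_Icc] at h1 h2
    rcases h.separated I (List.mem_toFinset.1 hI) J (List.mem_toFinset.1 hJ) hIJ with h | h <;>
      omega

end Tiles

/-! ### One pass over a row: tilings, flatness, number of intervals. -/

section merging

variable {row : ℕ → ℝ} {c τ : ℝ}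

theorem absorb_spec (b : ℕ) (rest : List (ℕ × ℕ)) : ∀ {a : ℕ}, Tiles a rest →
    Tiles (absorb row c b a rest).1 (absorb row c b a rest).2 ∧
    (absorb row c b a rest).1 ≤ a ∧
    (absorb row c b a rest).2 ⊆ rest ∧
    ∀ J ∈ rest, J ∈ (absorb row c b a rest).2 ∨ (absorb row c b a rest).1 ≤ J.1 := by
  induction rest with
  | nil => intro a h; simpa [absorb] using h
  | cons I rest ih =>
      intro a h
      unfold absorb
      split_ifs with hc
      · obtain ⟨h1, h2, h3⟩ := h
        obtain ⟨k1, k2, k3, k4⟩ := ih h3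
        refine ⟨k1, by omega, fun J hJ => List.mem_cons_of_mem _ (k3 hJ), fun J hJ => ?_⟩
        rcases List.mem_cons.1 hJ with rfl | hJ
        · exact Or.inr k2
        · exact k4 J hJ
      · exact ⟨h, le_rfl, fun J hJ => hJ, fun J hJ => Or.inl hJ⟩

theorem candidate_spec (b : ℕ) {a : ℕ} {rest : List (ℕ × ℕ)} (h : Tiles a rest) :
    Tiles (candidate row c a b rest).1 (candidate row c a b rest).2 ∧
    (candidate row c a b rest).1 ≤ a ∧
    (candidate row c a b rest).2 ⊆ rest ∧
    ∀ J ∈ rest, J ∈ (candidate row c a b rest).2 ∨ (candidate row c a b rest).1 ≤ J.1 := by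
  unfold candidate
  split_ifs
  · exact absorb_spec b rest h
  · exact ⟨h, le_rfl, fun J hJ => hJ, fun J hJ => Or.inl hJ⟩

theorem mergePass_tiles (l : List (ℕ × ℕ)) :
    ∀ {m : ℕ}, Tiles m l → Tiles m (mergePass row c τ l) := by
  induction l using mergePass.induct row c τ with
  | case1 => intro m h; simpa [mergePass] using h
  | case2 I rest hI =>
      intro m h
      rw [mergePass, if_pos hI]
      exact ⟨Nat.zero_le _, h.2.1, rfl⟩
  | case3 I rest hI ih =>
      intro m h
      obtain ⟨k1, k2, -, -⟩ := candidate_spec (row := row) (c := c) I.2 h.2.2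
      rw [mergePass, if_neg hI]
      exact ⟨k2.trans h.1, h.2.1, ih k1⟩

/-- Merging moves only left ends. Hence no new prefix sum is needed for the old positions, which is
the basis of the space bound. -/
theorem mergePass_right_end (l : List (ℕ × ℕ)) : ∀ {m : ℕ}, Tiles m l →
    ∀ I ∈ mergePass row c τ l, ∃ J ∈ l, J.2 = I.2 := by
  induction l using mergePass.induct row c τ with
  | case1 => simp [mergePass]
  | case2 A rest hA =>
      intro m h I hI
      rw [mergePass, if_pos hA, List.mem_singleton] at hI
      exact ⟨A, by simp, by rw [hI]⟩
  | case3 A rest hA ih =>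
      intro m h I hI
      obtain ⟨k1, -, k3, -⟩ := candidate_spec (row := row) (c := c) A.2 h.2.2
      rw [mergePass, if_neg hA] at hI
      rcases List.mem_cons.1 hI with rfl | hI
      · exact ⟨A, by simp, rfl⟩
      · obtain ⟨J, hJ, e⟩ := ih k1 I hI
        exact ⟨J, List.mem_cons_of_mem _ (k3 hJ), e⟩

theorem mergePass_coarsens (l : List (ℕ × ℕ)) : ∀ {m : ℕ}, Tiles m l →
    ∀ J ∈ l, ∃ I ∈ mergePass row c τ l, I.1 ≤ J.1 ∧ J.2 ≤ I.2 := by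
  induction l using mergePass.induct row c τ with
  | case1 => simp
  | case2 A rest hA =>
      intro m h J hJ
      rw [mergePass, if_pos hA]
      have := h.bounds J hJ
      have := h.2.1
      exact ⟨_, List.mem_singleton.2 rfl, Nat.zero_le _, by simp only; omega⟩
  | case3 A rest hA ih =>
      intro m h J hJ
      obtain ⟨k1, k2, -, k4⟩ := candidate_spec (row := row) (c := c) A.2 h.2.2
      rw [mergePass, if_neg hA]
      rcases List.mem_cons.1 hJ with rfl | hJ
      · exact ⟨_, List.mem_cons_self, k2, le_rfl⟩
      · rcases k4 J hJ with hJ' | hJ'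
        · obtain ⟨I, hI, e⟩ := ih k1 J hJ'
          exact ⟨I, List.mem_cons_of_mem _ hI, e⟩
        · have := h.2.2.bounds J hJ
          have := h.1
          exact ⟨_, List.mem_cons_self, hJ', by simp only; omega⟩

theorem absorb_ratio (b : ℕ) (rest : List (ℕ × ℕ)) : ∀ {a : ℕ},
    c ^ 2 ≤ row a / row (b + 1) → c ^ 2 ≤ row (absorb row c b a rest).1 / row (b + 1) := by
  induction rest with
  | nil => intro a h; simpa [absorb] using h
  | cons I rest ih =>
      intro a h
      unfold absorb
      split_ifs with hc
      · exact ih hc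
      · exact h

/-- The intervals of a row on which the row varies little or is small. -/
def IsFlat (row : ℕ → ℝ) (c τ : ℝ) (I : ℕ × ℕ) : Prop :=
  row I.2 ≤ τ ∨ c ^ 2 * row I.2 ≤ row I.1

theorem candidate_isFlat (hc0 : 0 < c) (hc1 : c < 1) {I : ℕ × ℕ} (rest : List (ℕ × ℕ))
    (hmono : row I.2 ≤ row (I.2 + 1)) (hI : IsFlat row c τ I) :
    IsFlat row c τ ((candidate row c I.1 I.2 rest).1, I.2) := by
  unfold candidate
  split_ifs with h
  · right
    -- The loop is entered with ratio above `c > c²` and keeps it at `c²` or more, so the threshold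
    -- `c²` is an invariant. It refers to the entry at `b + 1`, which dominates the one at `b` in
    -- the definition of flatness.
    have h1 : c ^ 2 ≤ row I.1 / row (I.2 + 1) := by nlinarith [h.2.2]
    have h2 := absorb_ratio (row := row) (c := c) I.2 rest h1
    rw [le_div_iff₀ h.2.1] at h2
    exact (mul_le_mul_of_nonneg_left hmono (sq_nonneg c)).trans h2
  · exact hI

theorem mergePass_isFlat (hc0 : 0 < c) (hc1 : c < 1) (l : List (ℕ × ℕ)) : ∀ {m : ℕ}, Tiles m l →
    (∀ j < m, row j ≤ row (j + 1)) → (∀ I ∈ l, IsFlat row c τ I) →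
    ∀ I ∈ mergePass row c τ l, IsFlat row c τ I := by
  induction l using mergePass.induct row c τ with
  | case1 => simp [mergePass]
  | case2 A rest hA =>
      intro m h _ _ I hI
      rw [mergePass, if_pos hA, List.mem_singleton] at hI
      exact Or.inl (by rw [hI]; exact hA)
  | case3 A rest hA ih =>
      intro m h hmono hl I hI
      obtain ⟨k1, k2, k3, -⟩ := candidate_spec (row := row) (c := c) A.2 h.2.2
      have h1 := h.1
      have h2 := h.2.1
      rw [mergePass, if_neg hA] at hI
      rcases List.mem_cons.1 hI with rfl | hI
      · exact candidate_isFlat hc0 hc1 rest (hmono _ (by omega)) (hl A (by simp))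
      · exact ih k1 (fun j hj => hmono j (by omega))
          (fun J hJ => hl J (List.mem_cons_of_mem _ (k3 hJ))) I hI

theorem absorb_head (b : ℕ) (rest : List (ℕ × ℕ)) : ∀ {a : ℕ} {J : ℕ × ℕ} {rest' : List (ℕ × ℕ)},
    (absorb row c b a rest).2 = J :: rest' → row J.1 / row (b + 1) < c ^ 2 := by
  induction rest with
  | nil => simp [absorb]
  | cons I rest ih =>
      intro a J rest'
      unfold absorb
      split_ifs with hc
      · exact ih
      · intro h
        obtain ⟨rfl, -⟩ := List.cons.inj h
        exact not_le.1 hc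

theorem mono_of_step {m : ℕ} (hmono : ∀ j < m, row j ≤ row (j + 1)) {a b : ℕ} (hab : a ≤ b)
    (hb : b ≤ m) : row a ≤ row b := by
  induction b, hab using Nat.le_induction with
  | base => exact le_rfl
  | succ b _ ih => exact (ih (by omega)).trans (hmono b (by omega))

theorem mergePass_length_le_one {m : ℕ} {l : List (ℕ × ℕ)} (h : Tiles m l)
    (hmono : ∀ j < m, row j ≤ row (j + 1)) (hτ : row m ≤ τ) :
    (mergePass row c τ l).length ≤ 1 := by
  cases l with
  | nil => simp [mergePass]
  | cons I rest =>
      have h2 := h.2.1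
      rw [mergePass, if_pos ((mono_of_step hmono (by omega) le_rfl).trans hτ)]
      simp

/-- Induction on the number of factors `c` that separate `row m`, just right of the current
interval, from `τ`. If no merging is attempted and intervals remain, one output interval already
lowers this entry by a factor `c`. If merging is attempted, it stops before some `J` with `row J.1 <
c² * row m`, so the current interval and the one that starts from `J` together lower it by at least
`c`. This costs at most two intervals per factor. -/
theorem mergePass_length_le (hc0 : 0 < c) (hc1 : c < 1) (k : ℕ) :
    ∀ {m : ℕ} {l : List (ℕ × ℕ)}, Tiles m l →
    (∀ j < m, row j ≤ row (j + 1)) → (∀ j ≤ m, 0 < row j) → row m * c ^ k ≤ τ →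
    (mergePass row c τ l).length ≤ 2 * k + 1 := by
  induction k with
  | zero =>
      intro m l h hmono _ hk
      exact mergePass_length_le_one h hmono (by simpa using hk)
  | succ k ih =>
      intro m l h hmono hpos hk
      rw [pow_succ] at hk
      cases l with
      | nil => simp [mergePass]
      | cons I rest =>
          obtain ⟨h1, h2, h3⟩ := h
          rw [mergePass]
          split_ifs with hI
          · simp
          obtain ⟨k1, k2, -, -⟩ := candidate_spec (row := row) (c := c) I.2 h3
          have hm : 0 < row (I.2 + 1) := hpos _ (by omega)
          rw [List.length_cons]
          by_cases hcond : rest ≠ [] ∧ 0 < row (I.2 + 1) ∧ c < row I.1 / row (I.2 + 1)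
          · have hcand : candidate row c I.1 I.2 rest = absorb row c I.2 I.1 rest := by
              rw [candidate, if_pos hcond]
            rw [hcand] at k1 k2 ⊢
            generalize habs : (absorb row c I.2 I.1 rest).2 = rest' at k1 ⊢
            cases rest' with
            | nil => simp [mergePass]
            | cons J rest₂ =>
                have hJ := absorb_head I.2 rest habs
                rw [div_lt_iff₀ hm, h2] at hJ
                have hJ1 := k1.1
                have hJ2 := k1.2.1
                obtain ⟨q1, q2, -, -⟩ := candidate_spec (row := row) (c := c) J.2 k1.2.2
                rw [mergePass]
                split_ifs with hJτ
                · simp only [List.length_singleton]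
                  omega
                rw [List.length_cons]
                have hq : row (candidate row c J.1 J.2 rest₂).1 ≤ row J.1 :=
                  mono_of_step hmono q2 (by omega)
                have := ih q1 (fun j hj => hmono j (by omega)) (fun j hj => hpos j (by omega)) (by
                  have hck : 0 < c ^ k := pow_pos hc0 k
                  have hm' := hpos m le_rfl
                  have h3 : c ^ 2 * row m ≤ c * row m := by
                    rw [sq, mul_assoc]
                    exact mul_le_of_le_one_left (by positivity) hc1.le
                  calc _ ≤ c * row m * c ^ k :=
                        mul_le_mul_of_nonneg_right (by linarith) hck.le
                    _ = row m * (c ^ k * c) := by ring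
                    _ ≤ τ := hk)
                omega
          · have hcand : candidate row c I.1 I.2 rest = (I.1, rest) := by
              rw [candidate, if_neg hcond]
            rw [hcand]
            simp only
            by_cases hr : rest = []
            · subst hr
              simp [mergePass]
            · have hle : row I.1 ≤ c * row m := by
                have : ¬ c < row I.1 / row (I.2 + 1) := fun h => hcond ⟨hr, hm, h⟩
                rwa [not_lt, div_le_iff₀ hm, h2] at this
              have := ih h3 (fun j hj => hmono j (by omega)) (fun j hj => hpos j (by omega)) (by
                  have hck : 0 < c ^ k := pow_pos hc0 k
                  nlinarith)
              omega

end merging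

theorem binRow_tiles (L : ℕ → ℕ → ℝ) (c τ : ℝ) (i : ℕ) : Tiles (i + 1) (binRow L c τ i) := by
  induction i with
  | zero => simp [binRow, Tiles]
  | succ i ih => exact ⟨le_rfl, rfl, mergePass_tiles _ ih⟩

theorem isBinning_binningOf {n : ℕ} (L : Matrix (Fin n) (Fin n) ℝ) (c τ : ℝ) :
    IsBinning (binningOf L c τ) := by
  refine ⟨fun i => (binRow_tiles _ c τ i).isIntervalPartition, fun i i' hi I hI => ?_⟩
  obtain ⟨J, hJ, h1, h2⟩ := mergePass_coarsens (row := entryAt L (i + 1)) (c := c) (τ := τ) _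
    (binRow_tiles (entryAt L) c τ i) I (List.mem_toFinset.1 hI)
  refine ⟨J, ?_, Finset.Icc_subset_Icc h1 h2⟩
  rw [binningOf, hi, List.mem_toFinset]
  exact List.mem_cons_of_mem _ hJ

theorem length_binRow_le_binningSize {n : ℕ} (L : Matrix (Fin n) (Fin n) ℝ) (c τ : ℝ) (i : Fin n) :
    (binRow (entryAt L) c τ i).length ≤ binningSize (binningOf L c τ) := by
  rw [← List.toFinset_card_of_nodup (binRow_tiles (entryAt L) c τ i).nodup]
  exact Finset.le_sup (f := fun i => (binningOf L c τ i).card) (Finset.mem_univ i)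

/-! ### The approximation of a matrix along a binning -/

/-- The value at `j` of the approximation of `row` along the partition `l`. -/
def binVal (row : ℕ → ℝ) : List (ℕ × ℕ) → ℕ → ℝ
  | [], _ => 0
  | I :: rest, j => if I.1 ≤ j then (row I.1 + row I.2) / 2 else binVal row rest j

theorem binVal_of_mem (row : ℕ → ℝ) {l : List (ℕ × ℕ)} : ∀ {m : ℕ}, Tiles m l → ∀ I ∈ l, ∀ j,
    I.1 ≤ j → j ≤ I.2 → binVal row l j = (row I.1 + row I.2) / 2 := by
  induction l with
  | nil => simp
  | cons A rest ih =>
      intro m h I hI j h1 h2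
      rcases List.mem_cons.1 hI with rfl | hI
      · rw [binVal, if_pos h1]
      · have := h.2.2.bounds I hI
        rw [binVal, if_neg (by omega)]
        exact ih h.2.2 I hI j h1 h2

theorem sum_binVal (row z : ℕ → ℝ) {l : List (ℕ × ℕ)} : ∀ {m : ℕ}, Tiles m l →
    ∑ j ∈ Finset.range m, binVal row l j * z j =
      (l.map fun I => (row I.1 + row I.2) / 2 * ∑ j ∈ Finset.Ico I.1 (I.2 + 1), z j).sum := by
  induction l with
  | nil => intro m h; simp only [Tiles] at h; simp [h]
  | cons A rest ih =>
      intro m h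
      obtain ⟨h1, h2, h3⟩ := h
      rw [List.map_cons, List.sum_cons, ← ih h3, ← h2, Finset.range_eq_Ico,
        ← Finset.sum_Ico_consecutive _ (Nat.zero_le A.1) (by omega : A.1 ≤ A.2 + 1), add_comm,
        Finset.mul_sum, ← Finset.range_eq_Ico]
      congr 1
      · refine Finset.sum_congr rfl fun j hj => ?_
        rw [binVal, if_pos (Finset.mem_Ico.1 hj).1]
      · refine Finset.sum_congr rfl fun j hj => ?_
        rw [binVal, if_neg (by simpa using hj)]

/-- The approximation of `L` along the output of the binning procedure. -/
def binApprox {n : ℕ} (L : Matrix (Fin n) (Fin n) ℝ) (c τ : ℝ) : Matrix (Fin n) (Fin n) ℝ :=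
  Matrix.of fun i j =>
    if j ≤ i then binVal (entryAt L i) (binRow (entryAt L) c τ i) j else 0

theorem isBinApprox_binApprox {n : ℕ} (L : Matrix (Fin n) (Fin n) ℝ) (c τ : ℝ) :
    IsBinApprox (binningOf L c τ) L (binApprox L c τ) := by
  have key : ∀ i j : Fin n, ∀ I ∈ binningOf L c τ i, (j : ℕ) ∈ Finset.Icc I.1 I.2 →
      binApprox L c τ i j = (entryAt L i I.1 + entryAt L i I.2) / 2 := by
    intro i j I hI hj
    have hI' := List.mem_toFinset.1 hI
    have hb := (binRow_tiles (entryAt L) c τ i).bounds I hI'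
    rw [Finset.mem_Icc] at hj
    have hji : j ≤ i := by rw [Fin.le_def]; omega
    rw [binApprox, Matrix.of_apply, if_pos hji]
    exact binVal_of_mem _ (binRow_tiles _ _ _ _) I hI' j hj.1 hj.2
  refine ⟨⟨?_, ?_⟩, fun i j _ I hI hj => key i j I hI hj⟩
  · intro i j hij
    have : i < j := hij
    rw [binApprox, Matrix.of_apply, if_neg (not_le.2 this)]
  · intro i I hI j j' hj hj'
    rw [key i j I hI hj, key i j' I hI hj']

/-- The newest position always forms an interval by itself, so the diagonal is exact; this makes the
approximation unitriangular, hence invertible. -/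
theorem binApprox_apply_self {n : ℕ} (L : Matrix (Fin n) (Fin n) ℝ) (c τ : ℝ) (i : Fin n) :
    binApprox L c τ i i = L i i := by
  have hmem : ((i : ℕ), (i : ℕ)) ∈ binRow (entryAt L) c τ i := by
    rcases i with ⟨_ | i, hi⟩ <;> simp [binRow]
  rw [binApprox, Matrix.of_apply, if_pos le_rfl,
    binVal_of_mem _ (binRow_tiles _ _ _ _) _ hmem _ le_rfl le_rfl]
  simp [entryAt]

theorem binApprox_mulVec {n : ℕ} (L : Matrix (Fin n) (Fin n) ℝ) (c τ : ℝ) (z : ℕ → ℝ) (i : Fin n) :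
    (binApprox L c τ *ᵥ fun j => z j) i =
      ((binRow (entryAt L) c τ i).map fun I =>
        (entryAt L i I.1 + entryAt L i I.2) / 2 * ∑ j ∈ Finset.Ico I.1 (I.2 + 1), z j).sum := by
  rw [← sum_binVal _ _ (binRow_tiles _ _ _ _), Matrix.mulVec, dotProduct]
  simp only [binApprox, Matrix.of_apply, ite_mul, zero_mul]
  rw [← Finset.sum_filter]
  refine Finset.sum_bij (fun j _ => (j : ℕ)) ?_ ?_ ?_ ?_
  · intro j hj
    have := (Finset.mem_filter.1 hj).2
    rw [Fin.le_def] at this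
    rw [Finset.mem_range]
    omega
  · intro j _ k _ h
    exact Fin.ext h
  · intro j hj
    have hj' := Finset.mem_range.1 hj
    have := i.2
    refine ⟨⟨j, by omega⟩, ?_, rfl⟩
    simp only [Finset.mem_filter, Finset.mem_univ, true_and, Fin.le_def]
    omega
  · intro j _
    rfl

/-! ### Errors of factorization mechanisms -/

open scoped NNReal in
-- The second moment of a centred sum is its variance, which is additive for independent
-- coordinates.
theorem integral_sq_sum_gaussian {m : ℕ} (v : ℝ≥0) (a : Fin m → ℝ) :
    ∫ z, (∑ j, a j * z j) ^ 2 ∂(Measure.pi fun _ : Fin m => gaussianReal 0 v) =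
      v * ∑ j, a j ^ 2 := by
  have hLp : ∀ j : Fin m, MemLp (fun x : ℝ => a j * x) 2 (gaussianReal 0 v) := fun j =>
    (memLp_id_gaussianReal' 2 (by simp)).const_mul (a j)
  have hmean : ∫ z, (∑ j, a j * z j) ∂(Measure.pi fun _ : Fin m => gaussianReal 0 v) = 0 := by
    rw [integral_finsetSum]
    · refine Finset.sum_eq_zero fun j _ => ?_
      rw [integral_const_mul, integral_eval]
      simp
    · intro j _
      exact ((hLp j).comp_measurePreserving (measurePreserving_eval _ j)).integrable (by simp)
  have hvar := variance_sum_pi (μ := fun _ : Fin m => gaussianReal 0 v) hLp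
  rw [variance_of_integral_eq_zero] at hvar
  · simp only [Finset.sum_apply] at hvar
    rw [hvar, Finset.mul_sum]
    exact Finset.sum_congr rfl fun j _ => by
      rw [variance_const_mul, variance_fun_id_gaussianReal, mul_comm]
  · exact Measurable.aemeasurable (by fun_prop)
  · simpa using hmean

open scoped NNReal in
theorem integrable_sq_sum_gaussian {m : ℕ} (v : ℝ≥0) (a : Fin m → ℝ) :
    Integrable (fun z => (∑ j, a j * z j) ^ 2)
      (Measure.pi fun _ : Fin m => gaussianReal 0 v) := by
  have hLp : ∀ j : Fin m, MemLp (fun x : ℝ => a j * x) 2 (gaussianReal 0 v) := fun j =>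
    (memLp_id_gaussianReal' 2 (by simp)).const_mul (a j)
  apply MemLp.integrable_sq
  exact memLp_finsetSum _ fun j _ =>
    (hLp j).comp_measurePreserving (measurePreserving_eval _ j)

theorem meanSE_eq (ε δ : ℝ) {n m : ℕ} (L : Matrix (Fin n) (Fin m) ℝ)
    (R : Matrix (Fin m) (Fin n) ℝ) :
    meanSE ε δ L R = 1 / (n : ℝ) *
      ∑ i, ((gaussianMechConst ε δ * sensitivity R ^ 2).toNNReal : ℝ) * ∑ j, L i j ^ 2 := by
  rw [meanSE, noiseLaw, integral_finsetSum]
  · congr 1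
    exact Finset.sum_congr rfl fun i _ => integral_sq_sum_gaussian _ (L i)
  · intro i _
    exact integrable_sq_sum_gaussian _ (L i)

theorem maxSE_eq (ε δ : ℝ) {n m : ℕ} (L : Matrix (Fin n) (Fin m) ℝ)
    (R : Matrix (Fin m) (Fin n) ℝ) :
    maxSE ε δ L R =
      ⨆ i, ((gaussianMechConst ε δ * sensitivity R ^ 2).toNNReal : ℝ) * ∑ j, L i j ^ 2 := by
  rw [maxSE, noiseLaw]
  exact iSup_congr fun i => integral_sq_sum_gaussian _ (L i)

theorem sensitivity_nonneg {m n : ℕ} (R : Matrix (Fin m) (Fin n) ℝ) : 0 ≤ sensitivity R := by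
  apply Real.sSup_nonneg
  rintro d ⟨x, x', -, rfl⟩
  exact norm_nonneg _

/-- Only finitely many pairs of binary streams exist. Boundedness matters because the real `sSup` of
an unbounded set is `0`. -/
theorem bddAbove_sensitivity {m n : ℕ} (R : Matrix (Fin m) (Fin n) ℝ) :
    BddAbove {d : ℝ | ∃ x x' : Fin n → ℝ, Neighboring x x' ∧
      d = ‖(WithLp.toLp 2 (R *ᵥ (x - x')) : EuclideanSpace ℝ (Fin m))‖} := by
  have hfin : {x : Fin n → ℝ | ∀ i, x i ∈ ({0, 1} : Set ℝ)}.Finite :=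
    Set.Finite.pi' fun _ => Set.toFinite _
  refine (((hfin.prod hfin).image fun p : (Fin n → ℝ) × (Fin n → ℝ) =>
    ‖(WithLp.toLp 2 (R *ᵥ (p.1 - p.2)) : EuclideanSpace ℝ (Fin m))‖).subset ?_).bddAbove
  rintro d ⟨x, x', ⟨h1, h2, -⟩, rfl⟩
  exact ⟨(x, x'), ⟨h1, h2⟩, rfl⟩

theorem sensitivity_le_mul {m m' n : ℕ} (R : Matrix (Fin m) (Fin n) ℝ)
    (R' : Matrix (Fin m') (Fin n) ℝ) {r : ℝ} (hr : 0 ≤ r)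
    (h : ∀ y, l2norm (R *ᵥ y) ≤ r * l2norm (R' *ᵥ y)) :
    sensitivity R ≤ r * sensitivity R' := by
  apply Real.sSup_le _ (mul_nonneg hr (sensitivity_nonneg R'))
  rintro d ⟨x, x', hx, rfl⟩
  exact (h _).trans (mul_le_mul_of_nonneg_left
    (le_csSup (bddAbove_sensitivity R') ⟨x, x', hx, rfl⟩) hr)

theorem gaussianMechConst_nonneg {ε δ : ℝ} (hδ : 0 < δ) (hδ1 : δ < 1) :
    0 ≤ gaussianMechConst ε δ := by
  unfold gaussianMechConst
  have : 0 ≤ Real.log (1.25 / δ) := by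
    apply Real.log_nonneg
    rw [le_div_iff₀ hδ]
    linarith
  positivity

/-! ### Comparison of the errors of two factorizations. -/

section comparison

variable {n m m' : ℕ} {ε δ q : ℝ} {L : Matrix (Fin n) (Fin m) ℝ} {R : Matrix (Fin m) (Fin n) ℝ}
  {L' : Matrix (Fin n) (Fin m') ℝ} {R' : Matrix (Fin m') (Fin n) ℝ}

theorem rowError_le {A r : ℝ} (hδ : 0 < δ) (hδ1 : δ < 1)
    (hL : ∀ i, ∑ j, L i j ^ 2 ≤ A * ∑ j, L' i j ^ 2)
    (hR : sensitivity R ≤ r * sensitivity R') (hq : A * r ^ 2 ≤ q) (i : Fin n) :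
    ((gaussianMechConst ε δ * sensitivity R ^ 2).toNNReal : ℝ) * ∑ j, L i j ^ 2 ≤
      q * (((gaussianMechConst ε δ * sensitivity R' ^ 2).toNNReal : ℝ) * ∑ j, L' i j ^ 2) := by
  have hg := gaussianMechConst_nonneg (ε := ε) hδ hδ1
  -- The noise variance is nonnegative because `δ < 1.25`, so the truncation has no effect.
  rw [Real.coe_toNNReal _ (by positivity), Real.coe_toNNReal _ (by positivity)]
  have hs := pow_le_pow_left₀ (sensitivity_nonneg R) hR 2
  have hS : 0 ≤ ∑ j, L' i j ^ 2 := Finset.sum_nonneg fun j _ => sq_nonneg _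
  calc _ ≤ gaussianMechConst ε δ * (r * sensitivity R') ^ 2 * (A * ∑ j, L' i j ^ 2) := by
        apply mul_le_mul (mul_le_mul_of_nonneg_left hs hg) (hL i)
          (Finset.sum_nonneg fun j _ => sq_nonneg _) (by positivity)
    _ = A * r ^ 2 * (gaussianMechConst ε δ * sensitivity R' ^ 2 * ∑ j, L' i j ^ 2) := by ring
    _ ≤ _ := mul_le_mul_of_nonneg_right hq (by positivity)

theorem meanSE_le
    (h : ∀ i, ((gaussianMechConst ε δ * sensitivity R ^ 2).toNNReal : ℝ) * ∑ j, L i j ^ 2 ≤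
      q * (((gaussianMechConst ε δ * sensitivity R' ^ 2).toNNReal : ℝ) * ∑ j, L' i j ^ 2)) :
    meanSE ε δ L R ≤ q * meanSE ε δ L' R' := by
  rw [meanSE_eq, meanSE_eq, mul_left_comm, Finset.mul_sum (a := q)]
  exact mul_le_mul_of_nonneg_left (Finset.sum_le_sum fun i _ => h i) (by positivity)

theorem maxSE_le (hq : 0 ≤ q)
    (h : ∀ i, ((gaussianMechConst ε δ * sensitivity R ^ 2).toNNReal : ℝ) * ∑ j, L i j ^ 2 ≤
      q * (((gaussianMechConst ε δ * sensitivity R' ^ 2).toNNReal : ℝ) * ∑ j, L' i j ^ 2)) :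
    maxSE ε δ L R ≤ q * maxSE ε δ L' R' := by
  rw [maxSE_eq, maxSE_eq]
  have hpos : ∀ i, 0 ≤ ((gaussianMechConst ε δ * sensitivity R' ^ 2).toNNReal : ℝ) *
      ∑ j, L' i j ^ 2 := fun i =>
    mul_nonneg (NNReal.coe_nonneg _) (Finset.sum_nonneg fun j _ => sq_nonneg _)
  apply Real.iSup_le _ (mul_nonneg hq (Real.iSup_nonneg hpos))
  intro i
  exact (h i).trans (mul_le_mul_of_nonneg_left
    (le_ciSup (f := fun i => ((gaussianMechConst ε δ * sensitivity R' ^ 2).toNNReal : ℝ) *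
      ∑ j, L' i j ^ 2) (Set.finite_range _).bddAbove i) hq)

end comparison

/-! ### The binned square root -/

section binnedSqrt

variable {α β c τ : ℝ} {n : ℕ}

theorem entryAt_sqrtCountingMatrix {i j : ℕ} (hi : i < n) (hj : j ≤ i) :
    entryAt (sqrtCountingMatrix α β n) i j = sqrtCoeff α β (i - j) := by
  rw [entryAt, dif_pos ⟨hi, by omega⟩]
  simp [sqrtCountingMatrix, hj]

theorem entryAt_sqrt_mono (hβ : 0 ≤ β) (hαβ : β < α) (hα : α ≤ 1) {i j k : ℕ} (hi : i < n)
    (hjk : j ≤ k) (hk : k ≤ i) :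
    entryAt (sqrtCountingMatrix α β n) i j ≤ entryAt (sqrtCountingMatrix α β n) i k := by
  rw [entryAt_sqrtCountingMatrix hi (by omega), entryAt_sqrtCountingMatrix hi hk]
  exact sqrtCoeff_antitone hβ hαβ hα (by omega)

/-- One row further down, both coefficient indices grow by one: small values stay small by
monotonicity, and the ratio of the end values does not drop by log-convexity. -/
theorem isFlat_next_row (hβ : 0 ≤ β) (hαβ : β < α) (hα : α ≤ 1) {i : ℕ} (hi : i + 1 < n)
    {I : ℕ × ℕ} (h1 : I.1 ≤ I.2) (h2 : I.2 ≤ i)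
    (h : IsFlat (entryAt (sqrtCountingMatrix α β n) i) c τ I) :
    IsFlat (entryAt (sqrtCountingMatrix α β n) (i + 1)) c τ I := by
  unfold IsFlat at h ⊢
  rw [entryAt_sqrtCountingMatrix (by omega) h2, entryAt_sqrtCountingMatrix (by omega) (by omega)]
    at h
  rw [entryAt_sqrtCountingMatrix hi (by omega), entryAt_sqrtCountingMatrix hi (by omega)]
  obtain ⟨j, hj⟩ : ∃ j, i = I.2 + j := ⟨i - I.2, by omega⟩
  obtain ⟨d, hd⟩ : ∃ d, I.2 = I.1 + d := ⟨I.2 - I.1, by omega⟩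
  rw [show i - I.2 = j by omega, show i - I.1 = j + d by omega] at h
  rw [show i + 1 - I.2 = j + 1 by omega, show i + 1 - I.1 = j + d + 1 by omega]
  rcases h with h | h
  · exact Or.inl ((sqrtCoeff_antitone hβ hαβ hα (Nat.le_succ j)).trans h)
  · right
    have p0 := sqrtCoeff_pos hβ hαβ j
    have p1 := sqrtCoeff_pos hβ hαβ (j + 1)
    have hl := sqrtCoeff_logConvex hβ hαβ j d
    refine le_of_mul_le_mul_left ?_ p0
    calc _ = c ^ 2 * sqrtCoeff α β j * sqrtCoeff α β (j + 1) := by ring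
      _ ≤ sqrtCoeff α β (j + d) * sqrtCoeff α β (j + 1) := mul_le_mul_of_nonneg_right h p1.le
      _ ≤ _ := hl

theorem binRow_isFlat (hβ : 0 ≤ β) (hαβ : β < α) (hα : α ≤ 1) (hc0 : 0 < c) (hc1 : c < 1) (i : ℕ)
    (hi : i < n) : ∀ I ∈ binRow (entryAt (sqrtCountingMatrix α β n)) c τ i,
      IsFlat (entryAt (sqrtCountingMatrix α β n) i) c τ I := by
  have hdiag : ∀ i < n, IsFlat (entryAt (sqrtCountingMatrix α β n) i) c τ (i, i) := by
    intro i hi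
    right
    rw [entryAt_sqrtCountingMatrix hi le_rfl, Nat.sub_self, sqrtCoeff_zero]
    nlinarith
  induction i with
  | zero =>
      intro I hI
      rw [binRow, List.mem_singleton] at hI
      subst hI
      exact hdiag 0 hi
  | succ i ih =>
      intro I hI
      rw [binRow] at hI
      rcases List.mem_cons.1 hI with rfl | hI
      · exact hdiag _ hi
      · have ht := binRow_tiles (entryAt (sqrtCountingMatrix α β n)) c τ i
        refine mergePass_isFlat hc0 hc1 _ ht ?_ ?_ I hI
        · intro j hj
          exact entryAt_sqrt_mono hβ hαβ hα hi (Nat.le_succ j) (by omega)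
        · intro J hJ
          have := ht.bounds J hJ
          exact isFlat_next_row hβ hαβ hα hi this.1 (by omega) (ih (by omega) J hJ)

theorem length_binRow_le (hβ : 0 ≤ β) (hαβ : β < α) (hα : α ≤ 1) (hc0 : 0 < c) (hc1 : c < 1)
    {k : ℕ} (hk : c ^ k ≤ τ) (i : ℕ) (hi : i < n) :
    (binRow (entryAt (sqrtCountingMatrix α β n)) c τ i).length ≤ 2 * k + 2 := by
  cases i with
  | zero => simp [binRow]
  | succ i =>
      rw [binRow, List.length_cons]
      have := mergePass_length_le (τ := τ) hc0 hc1 k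
        (binRow_tiles (entryAt (sqrtCountingMatrix α β n)) c τ i)
        (row := entryAt (sqrtCountingMatrix α β n) (i + 1))
        (fun j hj => entryAt_sqrt_mono hβ hαβ hα hi (Nat.le_succ j) (by omega))
        (fun j hj => by
          rw [entryAt_sqrtCountingMatrix hi (by omega)]; exact sqrtCoeff_pos hβ hαβ _)
        (by rw [entryAt_sqrtCountingMatrix hi le_rfl, Nat.sub_self, sqrtCoeff_zero, one_mul]
            exact hk)
      omega

/-- An entry `w` and the average of the end values `x ≤ w ≤ y` differ by at most `(y - x) / 2`. On a
small interval this is below `τ`. Otherwise `x ≥ c² y` gives `y - x ≤ (1 - c)(1 + c) y`, and `y ≤ 4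
w` because `c ≥ 1/2`. -/
theorem abs_sub_binApprox_le (hβ : 0 ≤ β) (hαβ : β < α) (hα : α ≤ 1) (hc0 : 1 / 2 ≤ c)
    (hc1 : c < 1) (hτ : 0 ≤ τ) (i j : Fin n) (hij : j ≤ i) :
    |(sqrtCountingMatrix α β n - binApprox (sqrtCountingMatrix α β n) c τ) i j| ≤
      4 * (1 - c) * sqrtCoeff α β ((i : ℕ) - j) + τ := by
  set B := sqrtCountingMatrix α β n with hB
  have hij' : (j : ℕ) ≤ i := hij
  obtain ⟨I, hI, h1, h2⟩ := (binRow_tiles (entryAt B) c τ i).exists_mem j (by omega)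
  have hb := (binRow_tiles (entryAt B) c τ i).bounds I hI
  have hflat := binRow_isFlat (τ := τ) hβ hαβ hα (by linarith) hc1 i i.2 I hI
  rw [Matrix.sub_apply, binApprox, Matrix.of_apply, if_pos hij,
    binVal_of_mem _ (binRow_tiles _ _ _ _) I hI j h1 h2]
  have hBij : B i j = entryAt B i j := by simp [entryAt]
  have e : sqrtCoeff α β ((i : ℕ) - j) = entryAt B i j :=
    (entryAt_sqrtCountingMatrix i.2 hij').symm
  rw [hBij, e]
  have m1 : entryAt B i I.1 ≤ entryAt B i j := entryAt_sqrt_mono hβ hαβ hα i.2 h1 hij'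
  have m2 : entryAt B i j ≤ entryAt B i I.2 := entryAt_sqrt_mono hβ hαβ hα i.2 h2 (by omega)
  have m0 : 0 < entryAt B i I.1 := by
    rw [hB, entryAt_sqrtCountingMatrix i.2 (by omega)]
    exact sqrtCoeff_pos hβ hαβ _
  unfold IsFlat at hflat
  rw [← hB] at hflat
  generalize entryAt B i I.1 = x at *
  generalize entryAt B i I.2 = y at *
  generalize entryAt B i j = w at *
  rcases hflat with h | h
  · have : 0 ≤ 4 * (1 - c) * w := mul_nonneg (by linarith) (by linarith)
    rw [abs_le]
    constructor <;> linarith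
  · have hc2 : 1 / 4 ≤ c ^ 2 := by nlinarith
    have hy : y / 4 ≤ w := by nlinarith [mul_le_mul_of_nonneg_right hc2 (show 0 ≤ y by linarith)]
    have h3 : y - x ≤ 8 * (1 - c) * w := by
      have : y - x ≤ (1 - c) * ((1 + c) * y) := by nlinarith
      have h4 : (1 + c) * y ≤ 8 * w := by nlinarith
      nlinarith
    rw [abs_le]
    constructor <;> linarith

theorem det_binApprox : (binApprox (sqrtCountingMatrix α β n) c τ).det = 1 := by
  rw [Matrix.det_of_isLowerTriangular _ (isBinApprox_binApprox _ c τ).1.1]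
  refine Finset.prod_eq_one fun i _ => ?_
  rw [binApprox_apply_self]
  simp [sqrtCountingMatrix, sqrtCoeff_zero]

/-- The bound on the relative errors, with `ρ` the total weight of the entrywise error bound. -/
theorem l2norm_right_factor_le (hβ : 0 ≤ β) (hαβ : β < α) (hα : α ≤ 1) (hc0 : 1 / 2 ≤ c)
    (hc1 : c < 1) (hτ : 0 ≤ τ) {ρ : ℝ}
    (hρ : ∑ k ∈ Finset.range n, (4 * (1 - c) * sqrtCoeff α β k + τ) ≤ ρ) (hρ1 : 4 * ρ < 1)
    (y : Fin n → ℝ) :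
    l2norm (((binApprox (sqrtCountingMatrix α β n) c τ)⁻¹ *
        (sqrtCountingMatrix α β n * sqrtCountingMatrix α β n)) *ᵥ y) ≤
      (1 - 4 * ρ)⁻¹ * l2norm (sqrtCountingMatrix α β n *ᵥ y) := by
  set B := sqrtCountingMatrix α β n with hB
  set M := binApprox B c τ with hM
  have hdet : IsUnit M.det := by
    rw [hM, hB, det_binApprox]
    exact isUnit_one
  set v := B *ᵥ y with hv
  set w := (M⁻¹ * (B * B)) *ᵥ y with hw
  have hMw : M *ᵥ w = B *ᵥ v := by
    rw [hw, hv, Matrix.mulVec_mulVec, ← Matrix.mul_assoc, Matrix.mul_nonsing_inv _ hdet,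
      Matrix.one_mul, Matrix.mulVec_mulVec]
  -- Since `M w = B v`, the deviation of `w` from `v` is controlled by `B⁻¹ (B - M) w`, of norm at
  -- most `4ρ ‖w‖`.
  have hE : B *ᵥ (w - v) = (B - M) *ᵥ w := by
    rw [Matrix.mulVec_sub, Matrix.sub_mulVec, hMw]
  have h1 := l2norm_le_sqrtCountingMatrix hβ hαβ hα n (w - v)
  rw [← hB, hE] at h1
  have h2 : l2norm ((B - M) *ᵥ w) ≤ ρ * l2norm w := by
    refine (l2norm_mulVec_le (B - M) (fun k => 4 * (1 - c) * sqrtCoeff α β k + τ) ?_ ?_ ?_ w).trans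
      (mul_le_mul_of_nonneg_right hρ (l2norm_nonneg w))
    · intro k
      have := (sqrtCoeff_pos hβ hαβ k).le
      have : 0 ≤ 4 * (1 - c) := by linarith
      positivity
    · intro i j hij
      exact abs_sub_binApprox_le hβ hαβ hα hc0 hc1 hτ i j hij
    · intro i j hij
      simp [hM, binApprox, hB, sqrtCountingMatrix, not_le.2 hij]
  have h3 : l2norm w ≤ l2norm v + l2norm (w - v) := by
    simpa using l2norm_add_le v (w - v)
  rw [inv_mul_eq_div, le_div_iff₀ (by linarith)]
  linarith

/-- The triangle inequality separates the relative error from the additive error `τ`. The latter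
becomes relative as well because the unit diagonal gives each row of the square root norm at least
`1`. -/
theorem l2norm_row_le (hβ : 0 ≤ β) (hαβ : β < α) (hα : α ≤ 1) (hc0 : 1 / 2 ≤ c)
    (hc1 : c < 1) (hτ : 0 ≤ τ) (i : Fin n) :
    ∑ j, binApprox (sqrtCountingMatrix α β n) c τ i j ^ 2 ≤
      (1 + (4 * (1 - c) + n * τ)) ^ 2 * ∑ j, sqrtCountingMatrix α β n i j ^ 2 := by
  set B := sqrtCountingMatrix α β n with hB
  set M := binApprox B c τ with hM
  rw [← l2norm_sq, ← l2norm_sq, ← mul_pow]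
  apply pow_le_pow_left₀ (l2norm_nonneg _)
  have hn : (1 : ℝ) ≤ n := by exact_mod_cast i.pos
  have hBpos : ∀ j, 0 ≤ B i j := fun j => by
    simp only [hB, sqrtCountingMatrix, Matrix.of_apply]
    split_ifs
    · exact (sqrtCoeff_pos hβ hαβ _).le
    · exact le_rfl
  have hBi : 1 ≤ l2norm (B i) := by
    apply le_of_sq_le_sq _ (l2norm_nonneg _)
    rw [l2norm_sq, one_pow]
    have : B i i ^ 2 = 1 := by simp [hB, sqrtCountingMatrix, sqrtCoeff_zero]
    rw [← this]
    exact Finset.single_le_sum (f := fun j => B i j ^ 2) (fun j _ => sq_nonneg _)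
      (Finset.mem_univ i)
  have hone : l2norm (fun _ : Fin n => τ) ≤ n * τ := by
    apply le_of_sq_le_sq _ (by positivity)
    rw [l2norm_sq, mul_pow]
    simp only [Finset.sum_const, Finset.card_univ, Fintype.card_fin, nsmul_eq_mul]
    exact mul_le_mul_of_nonneg_right (by nlinarith) (sq_nonneg τ)
  have hsmul : l2norm (fun j => (1 + 4 * (1 - c)) * B i j) = (1 + 4 * (1 - c)) * l2norm (B i) := by
    rw [← Real.norm_of_nonneg (show 0 ≤ 1 + 4 * (1 - c) by linarith)]
    simp only [l2norm]
    rw [← norm_smul]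
    simp only [Real.norm_of_nonneg (show 0 ≤ 1 + 4 * (1 - c) by linarith)]
    rfl
  set u : Fin n → ℝ := fun j => (1 + 4 * (1 - c)) * B i j with hu
  set t : Fin n → ℝ := fun _ => τ with ht
  have hle : ∀ j, |M i j| ≤ (u + t) j := by
    intro j
    simp only [Pi.add_apply, hu, ht]
    by_cases hij : j ≤ i
    · have := abs_sub_binApprox_le hβ hαβ hα hc0 hc1 hτ i j hij
      rw [← hB, ← hM, Matrix.sub_apply] at this
      have e : B i j = sqrtCoeff α β ((i : ℕ) - j) := by simp [hB, sqrtCountingMatrix, hij]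
      rw [← e] at this
      have h1 := abs_sub_abs_le_abs_sub (M i j) (B i j)
      rw [abs_sub_comm, abs_of_nonneg (hBpos j)] at h1
      linarith
    · have : M i j = 0 := by simp [hM, binApprox, hij]
      rw [this, abs_zero]
      have := hBpos j
      have : 0 ≤ 1 + 4 * (1 - c) := by linarith
      positivity
  calc l2norm (M i) ≤ l2norm (u + t) := l2norm_le_of_abs_le _ _ hle
    _ ≤ l2norm u + l2norm t := l2norm_add_le _ _
    _ ≤ (1 + 4 * (1 - c)) * l2norm (B i) + n * τ := by rw [hsmul]; linarith
    _ ≤ (1 + (4 * (1 - c) + n * τ)) * l2norm (B i) := by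
        nlinarith [mul_le_mul_of_nonneg_left hBi (show (0 : ℝ) ≤ n * τ by positivity)]

end binnedSqrt

/-! ### Space -/

/-- Reduces the existence of a linear update to a kernel inclusion: whatever vanishes on old state
and input must vanish on new state and output. -/
theorem exists_linearMap_of_ker_le {V W U : Type*} [AddCommGroup V] [AddCommGroup W]
    [AddCommGroup U] [Module ℝ V] [Module ℝ W] [Module ℝ U] (f : V →ₗ[ℝ] W) (g : V →ₗ[ℝ] U)
    (h : ∀ v, f v = 0 → g v = 0) : ∃ u : W →ₗ[ℝ] U, ∀ v, u (f v) = g v := by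
  obtain ⟨r, hr⟩ := f.rangeRestrict.exists_rightInverse_of_surjective
    (LinearMap.range_eq_top.2 f.surjective_rangeRestrict)
  obtain ⟨u, hu⟩ := LinearMap.exists_extend (g ∘ₗ r)
  refine ⟨u, fun v => ?_⟩
  have h1 : u (f v) = g (r (f.rangeRestrict v)) :=
    LinearMap.congr_fun hu (f.rangeRestrict v)
  have h2 : f (r (f.rangeRestrict v)) = f v :=
    congrArg Subtype.val (LinearMap.congr_fun hr (f.rangeRestrict v))
  rw [h1, ← sub_eq_zero, ← map_sub]
  apply h
  rw [map_sub, h2, sub_self]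

/-- The sequence of the coordinates of a vector, continued by zeros. -/
def extendByZero (n : ℕ) : (Fin n → ℝ) →ₗ[ℝ] (ℕ → ℝ) :=
  LinearMap.pi fun k => if h : k < n then LinearMap.proj ⟨k, h⟩ else 0

theorem extendByZero_apply {n : ℕ} (z : Fin n → ℝ) (i : Fin n) : extendByZero n z i = z i := by
  simp [extendByZero]

/-- The sum of the first `k` coordinates. -/
def prefixSum (n k : ℕ) : (Fin n → ℝ) →ₗ[ℝ] ℝ :=
  ∑ j ∈ Finset.range k, LinearMap.proj j ∘ₗ extendByZero n

theorem prefixSum_apply {n k : ℕ} (z : Fin n → ℝ) :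
    prefixSum n k z = ∑ j ∈ Finset.range k, extendByZero n z j := by
  simp [prefixSum]

/-- The prefix sums up to the right end points of the intervals of a partition. -/
def rightEndSums (n q : ℕ) (l : List (ℕ × ℕ)) : (Fin n → ℝ) →ₗ[ℝ] (Fin q → ℝ) :=
  LinearMap.pi fun k => if h : (k : ℕ) < l.length then prefixSum n (l[(k : ℕ)].2 + 1) else 0

theorem rightEndSums_eq_zero_iff {n q : ℕ} {l : List (ℕ × ℕ)} (hq : l.length ≤ q)
    (z : Fin n → ℝ) :
    rightEndSums n q l z = 0 ↔ ∀ I ∈ l, prefixSum n (I.2 + 1) z = 0 := by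
  constructor
  · intro h I hI
    obtain ⟨k, hk, rfl⟩ := List.getElem_of_mem hI
    have := congrFun h ⟨k, by omega⟩
    simpa [rightEndSums, hk] using this
  · intro h
    funext k
    simp only [rightEndSums, LinearMap.pi_apply, Pi.zero_apply]
    split_ifs with hk
    · exact h _ (List.getElem_mem hk)
    · rfl

theorem binApprox_mulVec_eq_zero {n : ℕ} (L : Matrix (Fin n) (Fin n) ℝ) (c τ : ℝ) (z : Fin n → ℝ)
    (i : Fin n) (h : ∀ I ∈ binRow (entryAt L) c τ i, prefixSum n (I.2 + 1) z = 0) :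
    (binApprox L c τ *ᵥ z) i = 0 := by
  have hz : z = fun j : Fin n => extendByZero n z j := by
    funext j; rw [extendByZero_apply]
  conv_lhs => rw [hz]
  rw [binApprox_mulVec]
  apply List.sum_eq_zero
  intro x hx
  obtain ⟨I, hI, rfl⟩ := List.mem_map.1 hx
  have hb := (binRow_tiles (entryAt L) c τ i).bounds I hI
  have h1 := h I hI
  have h0 : prefixSum n I.1 z = 0 := by
    rcases (binRow_tiles (entryAt L) c τ i).left_eq_zero_or I hI with h0 | ⟨J, hJ, h0⟩
    · rw [h0, prefixSum_apply, Finset.sum_range_zero]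
    · rw [← h0]; exact h J hJ
  rw [prefixSum_apply] at h0 h1
  rw [Finset.sum_Ico_eq_sub _ (by omega), h1, h0, sub_self, mul_zero]

theorem prefixSum_binRow_eq_zero {n : ℕ} (L : ℕ → ℕ → ℝ) (c τ : ℝ) (z : Fin n → ℝ) (i : ℕ)
    (hi : i + 1 < n) (h : ∀ I ∈ binRow L c τ i, prefixSum n (I.2 + 1) z = 0)
    (hz : z ⟨i + 1, hi⟩ = 0) :
    ∀ I ∈ binRow L c τ (i + 1), prefixSum n (I.2 + 1) z = 0 := by
  intro I hI
  rw [binRow] at hI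
  rcases List.mem_cons.1 hI with rfl | hI
  -- Row `i` ends with the singleton `i`, so the prefix sum up to `i` is part of the old state; the
  -- new one adds only the new input.
  · have hhead : (i, i) ∈ binRow L c τ i := by cases i <;> simp [binRow]
    have h1 := h _ hhead
    rw [prefixSum_apply] at h1 ⊢
    rw [Finset.sum_range_succ, h1, zero_add]
    exact (extendByZero_apply z ⟨i + 1, hi⟩).trans hz
  · obtain ⟨J, hJ, e⟩ := mergePass_right_end _ (binRow_tiles L c τ i) I hI
    rw [← e]
    exact h J hJ

theorem hasLinearStreaming_binApprox {n : ℕ} (L : Matrix (Fin n) (Fin n) ℝ) (c τ : ℝ) :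
    HasLinearStreaming (binApprox L c τ) (binningSize (binningOf L c τ)) := by
  set q := binningSize (binningOf L c τ) with hq
  -- Before row `i` the state consists of the prefix sums for the partition of row `i - 1`; before
  -- row `0` it is zero.
  set A : ℕ → (Fin n → ℝ) →ₗ[ℝ] (Fin q → ℝ) := fun i =>
    match i with
    | 0 => 0
    | i + 1 => rightEndSums n q (binRow (entryAt L) c τ i) with hA
  have hstep : ∀ i : Fin n, ∃ u : ((Fin q → ℝ) × ℝ) →ₗ[ℝ] ((Fin q → ℝ) × ℝ),
      ∀ z : Fin n → ℝ, u (A i z, z i) = (A (i + 1) z, (binApprox L c τ *ᵥ z) i) := by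
    intro i
    apply exists_linearMap_of_ker_le ((A i).prod (LinearMap.proj i))
      ((A (i + 1)).prod (LinearMap.proj i ∘ₗ (binApprox L c τ).mulVecLin))
    intro z hz
    replace hz : A i z = 0 ∧ z i = 0 := Prod.mk_eq_zero.1 hz
    have key : ∀ I ∈ binRow (entryAt L) c τ i, prefixSum n (I.2 + 1) z = 0 := by
      obtain ⟨i, hi⟩ := i
      cases i with
      | zero =>
          intro I hI
          rw [binRow, List.mem_singleton] at hI
          rw [hI, prefixSum_apply, Finset.sum_range_one]
          exact (extendByZero_apply z ⟨0, hi⟩).trans hz.2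
      | succ i =>
          refine prefixSum_binRow_eq_zero _ c τ z i hi ?_ hz.2
          exact (rightEndSums_eq_zero_iff
            (length_binRow_le_binningSize L c τ ⟨i, by omega⟩) z).1 hz.1
    exact Prod.mk_eq_zero.2 ⟨(rightEndSums_eq_zero_iff (length_binRow_le_binningSize L c τ i) z).2 key,
      binApprox_mulVec_eq_zero L c τ z i key⟩
  choose u hu using hstep
  exact ⟨u, fun z => ⟨fun i => A i z, by simp [hA], fun i => hu i z⟩⟩

theorem spaceComplexity_binApprox_le {n : ℕ} (L : Matrix (Fin n) (Fin n) ℝ) (c τ : ℝ) :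
    spaceComplexity (binApprox L c τ) ≤ (binningSize (binningOf L c τ) : ℕ∞) :=
  iInf₂_le _ (hasLinearStreaming_binApprox L c τ)

/-! ### The program

Integer registers: `0` the current row `i`, `1` the bottom of the stored partition, `2` and `3`
the reading and the writing position, `4` and `5` the end points of the current interval. Real
registers: `0` the input, `1` and `2` the parameters `c` and `τ`, `3` the output, `4` the sum of
the inputs in the current interval. The intervals are stored from left to right: their end points
in the integer arrays `0` and `1`, their sums in the real array `0`. -/

namespace RealRAM

/-- Moves the next interval into the registers. -/
def loadProg : Prog :=
  .seq (.setIdx 2 (.pred (.reg 2))) <|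
  .seq (.setIdx 4 (.read 0 (.reg 2))) <|
  .seq (.setIdx 5 (.read 1 (.reg 2))) <|
  .setNum 4 (.read 0 (.reg 2))

/-- Absorbs the next interval into the current one. -/
def extendProg : Prog :=
  .seq (.setIdx 2 (.pred (.reg 2))) <|
  .seq (.setIdx 4 (.read 0 (.reg 2))) <|
  .setNum 4 (.add (.reg 4) (.read 0 (.reg 2)))

/-- There is a next interval. -/
def moreTest : Test := .idxLt (.reg 1) (.reg 2)

/-- The test of the inner loop. -/
def absorbTest : Test :=
  .and moreTest (.not (.numLt
    (.div (.entry (.reg 0) (.read 0 (.pred (.reg 2)))) (.entry (.reg 0) (.succ (.reg 5))))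
    (.mul (.reg 1) (.reg 1))))

/-- The test before the inner loop. -/
def candidateTest : Test :=
  .and moreTest (.and (.numLt (.lit 0) (.entry (.reg 0) (.succ (.reg 5))))
    (.numLt (.reg 1)
      (.div (.entry (.reg 0) (.reg 4)) (.entry (.reg 0) (.succ (.reg 5))))))

/-- Merges intervals into the current one. -/
def chooseProg : Prog :=
  .ite (.numLt (.reg 2) (.entry (.reg 0) (.reg 5)))
    (.ite candidateTest (.loop absorbTest extendProg) .skip)
    (.seq (.loop moreTest extendProg) (.setIdx 4 (.lit 0)))

/-- Writes the current interval into memory and adds its contribution to the output. -/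
def storeProg : Prog :=
  .seq (.setIdx 3 (.pred (.reg 3))) <|
  .seq (.writeIdx 0 (.reg 3) (.reg 4)) <|
  .seq (.writeIdx 1 (.reg 3) (.reg 5)) <|
  .seq (.writeNum 0 (.reg 3) (.reg 4)) <|
  .setNum 3 (.add (.reg 3) (.mul
    (.div (.add (.entry (.reg 0) (.reg 4)) (.entry (.reg 0) (.reg 5))) (.lit 2)) (.reg 4)))

/-- The pass over the partition of the previous row. -/
def passProg : Prog := .loop moreTest (.seq loadProg (.seq chooseProg storeProg))

/-- Prepares the pass over the partition of the previous row. -/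
def initProg : Prog :=
  .seq (.setIdx 2 (.reg 0)) <| .seq (.setIdx 3 (.reg 0)) <| .setNum 3 (.lit 0)

/-- Adds the interval that consists of the current position. -/
def pushProg : Prog :=
  .seq (.setIdx 1 (.reg 3)) <|
  .seq (.writeIdx 0 (.reg 0) (.reg 0)) <|
  .seq (.writeIdx 1 (.reg 0) (.reg 0)) <|
  .seq (.writeNum 0 (.reg 0) (.reg 0)) <|
  .seq (.setNum 3 (.add (.reg 3) (.mul
    (.div (.add (.entry (.reg 0) (.reg 0)) (.entry (.reg 0) (.reg 0))) (.lit 2)) (.reg 0)))) <|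
  .setIdx 0 (.succ (.reg 0))

/-- The program for one row. -/
def rowProg : Prog := .seq initProg (.seq passProg pushProg)

/-- The sum of `z` over an interval. -/
def intervalSum (z : ℕ → ℝ) (a b : ℕ) : ℝ := ∑ j ∈ Finset.Ico a (b + 1), z j

/-- The list `l`, read from its end, is stored together with the interval sums in the cells
`lo, …, p - 1`. -/
def Stored (z : ℕ → ℝ) (m : Memory) (lo : ℕ) : ℕ → List (ℕ × ℕ) → Prop
  | p, [] => p = lo
  | p, I :: rest => lo < p ∧ m.idxArr 0 (p - 1) = I.1 ∧ m.idxArr 1 (p - 1) = I.2 ∧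
      m.numArr 0 (p - 1) = intervalSum z I.1 I.2 ∧ Stored z m lo (p - 1) rest

theorem Stored.le {z : ℕ → ℝ} {m : Memory} {lo : ℕ} {l : List (ℕ × ℕ)} :
    ∀ {p : ℕ}, Stored z m lo p l → lo ≤ p := by
  cases l with
  | nil => intro p h; exact h.ge
  | cons I rest => intro p h; exact h.1.le

theorem Stored.congr {z : ℕ → ℝ} {m m' : Memory} {lo : ℕ} {l : List (ℕ × ℕ)} :
    ∀ {p : ℕ}, Stored z m lo p l → (∀ k, lo ≤ k → k < p → m'.idxArr 0 k = m.idxArr 0 k ∧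
      m'.idxArr 1 k = m.idxArr 1 k ∧ m'.numArr 0 k = m.numArr 0 k) → Stored z m' lo p l := by
  induction l with
  | nil => intro p h _; exact h
  | cons I rest ih =>
      rintro p ⟨h1, h2, h3, h4, h5⟩ hm
      obtain ⟨e1, e2, e3⟩ := hm (p - 1) (by omega) (by omega)
      exact ⟨h1, e1.trans h2, e2.trans h3, e3.trans h4, ih h5 fun k hk hk' => hm k hk (by omega)⟩

/-- The parts of the memory that the choice of the next interval leaves unchanged. -/
structure Same (m m' : Memory) : Prop where
  idxArr : m'.idxArr = m.idxArr
  numArr : m'.numArr = m.numArr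
  idx0 : m'.idx 0 = m.idx 0
  idx1 : m'.idx 1 = m.idx 1
  idx3 : m'.idx 3 = m.idx 3
  idx5 : m'.idx 5 = m.idx 5
  num0 : m'.num 0 = m.num 0
  num1 : m'.num 1 = m.num 1
  num2 : m'.num 2 = m.num 2
  num3 : m'.num 3 = m.num 3

theorem Same.refl (m : Memory) : Same m m :=
  ⟨rfl, rfl, rfl, rfl, rfl, rfl, rfl, rfl, rfl, rfl⟩

theorem Same.trans {m m' m'' : Memory} (h : Same m m') (h' : Same m' m'') : Same m m'' :=
  ⟨h'.idxArr.trans h.idxArr, h'.numArr.trans h.numArr, h'.idx0.trans h.idx0, h'.idx1.trans h.idx1,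
    h'.idx3.trans h.idx3, h'.idx5.trans h.idx5, h'.num0.trans h.num0, h'.num1.trans h.num1,
    h'.num2.trans h.num2, h'.num3.trans h.num3⟩

theorem Same.stored {z : ℕ → ℝ} {m m' : Memory} (h : Same m m') {lo p : ℕ} {l : List (ℕ × ℕ)}
    (hs : Stored z m lo p l) : Stored z m' lo p l :=
  hs.congr fun k _ _ => by rw [h.idxArr, h.numArr]; exact ⟨rfl, rfl, rfl⟩

/-! ### Correctness and running time of the program. -/

section correctness

variable {M : ℕ → ℕ → ℝ} {z : ℕ → ℝ}

theorem exec_load (m : Memory) : ∃ t ≤ 20, ∃ m', Exec M loadProg m t m' ∧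
    m'.idxArr = m.idxArr ∧ m'.numArr = m.numArr ∧ m'.idx 0 = m.idx 0 ∧ m'.idx 1 = m.idx 1 ∧
    m'.idx 2 = m.idx 2 - 1 ∧ m'.idx 3 = m.idx 3 ∧ m'.idx 4 = m.idxArr 0 (m.idx 2 - 1) ∧
    m'.idx 5 = m.idxArr 1 (m.idx 2 - 1) ∧ m'.num 0 = m.num 0 ∧ m'.num 1 = m.num 1 ∧
    m'.num 2 = m.num 2 ∧ m'.num 3 = m.num 3 ∧ m'.num 4 = m.numArr 0 (m.idx 2 - 1) := by
  refine ⟨_, ?_, _, .seq (.setIdx _ _ _) (.seq (.setIdx _ _ _) (.seq (.setIdx _ _ _)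
    (.setNum _ _ _))), ?_⟩
  · simp [IdxExpr.cost, NumExpr.cost]
  · simp [IdxExpr.val, NumExpr.val]

theorem exec_extend (m : Memory) : ∃ t ≤ 20, ∃ m', Exec M extendProg m t m' ∧ Same m m' ∧
    m'.idx 2 = m.idx 2 - 1 ∧ m'.idx 4 = m.idxArr 0 (m.idx 2 - 1) ∧
    m'.num 4 = m.num 4 + m.numArr 0 (m.idx 2 - 1) := by
  refine ⟨_, ?_, _, .seq (.setIdx _ _ _) (.seq (.setIdx _ _ _) (.setNum _ _ _)), ?_, ?_⟩
  · simp [IdxExpr.cost, NumExpr.cost]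
  · constructor <;> simp
  · simp [IdxExpr.val, NumExpr.val]

theorem exec_store (m : Memory) : ∃ t ≤ 40, ∃ m', Exec M storeProg m t m' ∧
    (∀ k, k ≠ m.idx 3 - 1 → m'.idxArr 0 k = m.idxArr 0 k ∧
      m'.idxArr 1 k = m.idxArr 1 k ∧ m'.numArr 0 k = m.numArr 0 k) ∧
    m'.idxArr 0 (m.idx 3 - 1) = m.idx 4 ∧ m'.idxArr 1 (m.idx 3 - 1) = m.idx 5 ∧
    m'.numArr 0 (m.idx 3 - 1) = m.num 4 ∧
    m'.idx 0 = m.idx 0 ∧ m'.idx 1 = m.idx 1 ∧ m'.idx 2 = m.idx 2 ∧ m'.idx 3 = m.idx 3 - 1 ∧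
    m'.num 0 = m.num 0 ∧ m'.num 1 = m.num 1 ∧ m'.num 2 = m.num 2 ∧
    m'.num 3 = m.num 3 +
      (M (m.idx 0) (m.idx 4) + M (m.idx 0) (m.idx 5)) / 2 * m.num 4 := by
  refine ⟨_, ?_, _, .seq (.setIdx _ _ _) (.seq (.writeIdx _ _ _ _) (.seq (.writeIdx _ _ _ _)
    (.seq (.writeNum _ _ _ _) (.setNum _ _ _)))), ?_⟩
  · simp [IdxExpr.cost, NumExpr.cost]
  · simp +contextual [IdxExpr.val, NumExpr.val]

theorem exec_init (m : Memory) : ∃ t ≤ 10, ∃ m', Exec M initProg m t m' ∧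
    m'.idxArr = m.idxArr ∧ m'.numArr = m.numArr ∧ m'.idx 0 = m.idx 0 ∧ m'.idx 1 = m.idx 1 ∧
    m'.idx 2 = m.idx 0 ∧ m'.idx 3 = m.idx 0 ∧ m'.num 0 = m.num 0 ∧ m'.num 1 = m.num 1 ∧
    m'.num 2 = m.num 2 ∧ m'.num 3 = 0 := by
  refine ⟨_, ?_, _, .seq (.setIdx _ _ _) (.seq (.setIdx _ _ _) (.setNum _ _ _)), ?_⟩
  · simp [IdxExpr.cost, NumExpr.cost]
  · simp [IdxExpr.val, NumExpr.val]

theorem exec_push (m : Memory) : ∃ t ≤ 40, ∃ m', Exec M pushProg m t m' ∧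
    (∀ k, k ≠ m.idx 0 → m'.idxArr 0 k = m.idxArr 0 k ∧
      m'.idxArr 1 k = m.idxArr 1 k ∧ m'.numArr 0 k = m.numArr 0 k) ∧
    m'.idxArr 0 (m.idx 0) = m.idx 0 ∧ m'.idxArr 1 (m.idx 0) = m.idx 0 ∧
    m'.numArr 0 (m.idx 0) = m.num 0 ∧ m'.idx 0 = m.idx 0 + 1 ∧ m'.idx 1 = m.idx 3 ∧
    m'.num 1 = m.num 1 ∧ m'.num 2 = m.num 2 ∧
    m'.num 3 = m.num 3 +
      (M (m.idx 0) (m.idx 0) + M (m.idx 0) (m.idx 0)) / 2 * m.num 0 := by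
  refine ⟨_, ?_, _, .seq (.setIdx _ _ _) (.seq (.writeIdx _ _ _ _) (.seq (.writeIdx _ _ _ _)
    (.seq (.writeNum _ _ _ _) (.seq (.setNum _ _ _) (.setIdx _ _ _))))), ?_⟩
  · simp [IdxExpr.cost, NumExpr.cost]
  · simp +contextual [IdxExpr.val, NumExpr.val]

theorem intervalSum_append (z : ℕ → ℝ) {a a' b' b : ℕ} (h1 : a' ≤ b') (h2 : b' + 1 = a)
    (h3 : a ≤ b + 1) : intervalSum z a b + intervalSum z a' b' = intervalSum z a' b := by
  unfold intervalSum
  rw [add_comm, h2, Finset.sum_Ico_consecutive _ (by omega) h3]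

/-- The state of the inner loops: the current interval is in the registers and `rest` is the part
of the partition on its left. -/
structure Current (z : ℕ → ℝ) (m : Memory) (rest : List (ℕ × ℕ)) : Prop where
  tiles : Tiles (m.idx 4) rest
  le : m.idx 4 ≤ m.idx 5
  stored : Stored z m (m.idx 1) (m.idx 2) rest
  sum : m.num 4 = intervalSum z (m.idx 4) (m.idx 5)

theorem Current.extend {m : Memory} {I : ℕ × ℕ} {rest : List (ℕ × ℕ)}
    (h : Current z m (I :: rest)) : ∃ t ≤ 20, ∃ m', Exec M extendProg m t m' ∧ Same m m' ∧
      m'.idx 2 = m.idx 2 - 1 ∧ m'.idx 4 = I.1 ∧ Current z m' rest := by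
  obtain ⟨t, ht, m', he, hs, e2, e4, e5⟩ := exec_extend (M := M) m
  obtain ⟨⟨t1, t2, t3⟩, hle, ⟨s1, s2, s3, s4, s5⟩, hsum⟩ := h
  rw [s2] at e4
  rw [s4, hsum, intervalSum_append z t1 t2 (by omega)] at e5
  refine ⟨t, ht, m', he, hs, e2, e4, ⟨?_, ?_, ?_, ?_⟩⟩
  · rwa [e4]
  · rw [e4, hs.idx5]; omega
  · rw [hs.idx1, e2]
    exact hs.stored s5
  · rw [e4, e5, hs.idx5]

theorem Current.moreTest_iff {m : Memory} {rest : List (ℕ × ℕ)} (h : Current z m rest) :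
    moreTest.Holds M m ↔ rest ≠ [] := by
  have hs := h.stored
  cases rest with
  | nil => simp only [Stored] at hs; simp [moreTest, Test.Holds, IdxExpr.val, hs]
  | cons I rest => simpa [moreTest, Test.Holds, IdxExpr.val] using hs.1

/-- The remaining length on the left of the time bound serves as a potential: each absorbed interval
pays for its own absorption, so the cost is amortized over the whole pass. -/
theorem exec_absorb (rest : List (ℕ × ℕ)) : ∀ {m : Memory}, Current z m rest →
    ∃ t m', Exec M (.loop absorbTest extendProg) m t m' ∧ Same m m' ∧ m'.idx 2 ≤ m.idx 2 ∧
      m'.idx 4 = (absorb (M (m.idx 0)) (m.num 1) (m.idx 5) (m.idx 4) rest).1 ∧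
      Current z m' (absorb (M (m.idx 0)) (m.num 1) (m.idx 5) (m.idx 4) rest).2 ∧
      t + 40 * (absorb (M (m.idx 0)) (m.num 1) (m.idx 5) (m.idx 4) rest).2.length ≤
        40 * rest.length + 20 := by
  have hcost : absorbTest.cost ≤ 20 := by decide
  induction rest with
  | nil =>
      intro m h
      have hno : ¬ absorbTest.Holds M m := fun hh => (h.moreTest_iff.1 hh.1) rfl
      refine ⟨_, m, .loopDone hno, Same.refl m, le_rfl, rfl, h, ?_⟩
      simpa [absorb] using hcost
  | cons I rest ih =>
      intro m h
      have htest : absorbTest.Holds M m ↔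
          m.num 1 ^ 2 ≤ M (m.idx 0) I.1 / M (m.idx 0) (m.idx 5 + 1) := by
        have hmore : moreTest.Holds M m := h.moreTest_iff.2 (by simp)
        unfold absorbTest
        simp only [Test.Holds, NumExpr.val, IdxExpr.val, hmore, true_and, not_lt,
          h.stored.2.1, sq]
      unfold absorb
      split_ifs with hc
      · obtain ⟨t, ht, m', he, hs, e2, e4, hcur⟩ := h.extend (M := M)
        obtain ⟨t', m'', he', hs', e2', e4', hcur', ht'⟩ := ih hcur
        rw [hs.idx0, hs.num1, hs.idx5, e4] at e4' hcur' ht'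
        refine ⟨_, m'', .loopStep (htest.2 hc) he he', hs.trans hs', by omega, e4', hcur', ?_⟩
        rw [List.length_cons]
        omega
      · refine ⟨_, m, .loopDone (mt htest.1 hc), Same.refl m, le_rfl, rfl, h, ?_⟩
        simp only
        omega

theorem exec_takeAll (rest : List (ℕ × ℕ)) : ∀ {m : Memory}, Current z m rest →
    ∃ t m', Exec M (.loop moreTest extendProg) m t m' ∧ Same m m' ∧ m'.idx 2 ≤ m.idx 2 ∧
      m'.idx 4 = 0 ∧ Current z m' [] ∧ t ≤ 40 * rest.length + 20 := by
  have hcost : moreTest.cost ≤ 20 := by decide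
  induction rest with
  | nil =>
      intro m h
      have hno : ¬ moreTest.Holds M m := fun hh => (h.moreTest_iff.1 hh) rfl
      refine ⟨_, m, .loopDone hno, Same.refl m, le_rfl, h.tiles, h, ?_⟩
      simpa using hcost
  | cons I rest ih =>
      intro m h
      obtain ⟨t, ht, m', he, hs, e2, e4, hcur⟩ := h.extend (M := M)
      obtain ⟨t', m'', he', hs', e2', e4', hcur', ht'⟩ := ih hcur
      refine ⟨_, m'', .loopStep (h.moreTest_iff.2 (by simp)) he he', hs.trans hs', by omega, e4',
        hcur', ?_⟩
      rw [List.length_cons]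
      omega

theorem exec_choose {m : Memory} {rest : List (ℕ × ℕ)} (h : Current z m rest) :
    ∃ t m' rest', Exec M chooseProg m t m' ∧ Same m m' ∧ m'.idx 2 ≤ m.idx 2 ∧
      mergePass (M (m.idx 0)) (m.num 1) (m.num 2) ((m.idx 4, m.idx 5) :: rest) =
        (m'.idx 4, m.idx 5) :: mergePass (M (m.idx 0)) (m.num 1) (m.num 2) rest' ∧
      Current z m' rest' ∧ rest'.length ≤ rest.length ∧
      t + 40 * rest'.length ≤ 40 * rest.length + 60 := by
  have hτ : (Test.numLt (.reg 2) (.entry (.reg 0) (.reg 5))).Holds M m ↔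
      ¬ M (m.idx 0) (m.idx 5) ≤ m.num 2 := by
    simp [Test.Holds, NumExpr.val, IdxExpr.val]
  have hτc : (Test.numLt (.reg 2) (.entry (.reg 0) (.reg 5))).cost ≤ 10 := by decide
  have hcc : candidateTest.cost ≤ 25 := by decide
  rw [mergePass]
  by_cases hI : M (m.idx 0) (m.idx 5) ≤ m.num 2
  · rw [if_pos hI]
    obtain ⟨t, m', he, hs, e2, e4, hcur, ht⟩ := exec_takeAll (M := M) rest h
    refine ⟨_, _, [], .iteFalse (fun hh => hτ.1 hh hI) (.seq he (.setIdx _ _ _)),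
      hs.trans ?_, ?_, ?_, ?_, Nat.zero_le _, ?_⟩
    · constructor <;> simp
    · simpa using e2
    · simp [mergePass, IdxExpr.val]
    · obtain ⟨c1, c2, c3, c4⟩ := hcur
      refine ⟨?_, ?_, ?_, ?_⟩
      · simp [Tiles, IdxExpr.val]
      · simp [IdxExpr.val]
      · simpa [Stored] using c3
      · simpa [IdxExpr.val, e4] using c4
    · simp only [IdxExpr.cost, List.length_nil]
      omega
  · rw [if_neg hI]
    have htest : candidateTest.Holds M m ↔ rest ≠ [] ∧ 0 < M (m.idx 0) (m.idx 5 + 1) ∧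
        m.num 1 < M (m.idx 0) (m.idx 4) / M (m.idx 0) (m.idx 5 + 1) := by
      rw [← h.moreTest_iff (M := M)]
      simp [candidateTest, Test.Holds, NumExpr.val, IdxExpr.val]
    unfold candidate
    split_ifs with hc
    · obtain ⟨t, m', he, hs, e2, e4, hcur, ht⟩ := exec_absorb (M := M) rest h
      refine ⟨_, m', _, .iteTrue (hτ.2 hI) (.iteTrue (htest.2 hc) he), hs, e2, ?_, hcur,
        absorb_length_le _ _ _ _ _, ?_⟩
      · rw [e4]
      · omega
    · refine ⟨_, m, rest, .iteTrue (hτ.2 hI) (.iteFalse (mt htest.1 hc) (.skip m)), Same.refl m,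
        le_rfl, rfl, h, le_rfl, ?_⟩
      omega

/-- The pass works in place. Each interval written consumes at least one interval read, so the
writing position never falls below the reading position (`m.idx 2 ≤ m.idx 3`) and no unread cell is
overwritten. -/
theorem exec_pass (k : ℕ) : ∀ {m : Memory} {l : List (ℕ × ℕ)} {r : ℕ}, l.length ≤ k → Tiles r l →
    Stored z m (m.idx 1) (m.idx 2) l → m.idx 2 ≤ m.idx 3 →
    ∃ t m', Exec M passProg m t m' ∧ t ≤ 200 * l.length + 10 ∧
      Stored z m' (m'.idx 3) (m.idx 3) (mergePass (M (m.idx 0)) (m.num 1) (m.num 2) l) ∧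
      (∀ j, m.idx 3 ≤ j → m'.idxArr 0 j = m.idxArr 0 j ∧ m'.idxArr 1 j = m.idxArr 1 j ∧
        m'.numArr 0 j = m.numArr 0 j) ∧
      m'.idx 0 = m.idx 0 ∧ m'.num 0 = m.num 0 ∧ m'.num 1 = m.num 1 ∧ m'.num 2 = m.num 2 ∧
      m'.num 3 = m.num 3 + ((mergePass (M (m.idx 0)) (m.num 1) (m.num 2) l).map fun I =>
        (M (m.idx 0) I.1 + M (m.idx 0) I.2) / 2 * intervalSum z I.1 I.2).sum := by
  have hcost : moreTest.cost ≤ 10 := by decide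
  induction k with
  | zero =>
      intro m l r hl _ hst _
      obtain rfl : l = [] := List.length_eq_zero_iff.1 (by omega)
      have hno : ¬ moreTest.Holds M m := by
        simp only [Stored] at hst
        simp [moreTest, Test.Holds, IdxExpr.val, hst]
      refine ⟨_, m, .loopDone hno, by simpa using hcost, ?_, fun j _ => ⟨rfl, rfl, rfl⟩, rfl, rfl,
        rfl, rfl, ?_⟩
      · simp [mergePass, Stored]
      · simp [mergePass]
  | succ k ih =>
      intro m l r hl hti hst hpw
      cases l with
      | nil => exact ih (by simp) hti hst hpw
      | cons I rest =>
          obtain ⟨s1, s2, s3, s4, s5⟩ := hst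
          obtain ⟨t1, ht1, m1, he1, a1, a2, a3, a4, a5, a6, a7, a8, a9, a10, a11, a12, a13⟩ :=
            exec_load (M := M) m
          rw [s2] at a7
          rw [s3] at a8
          rw [s4] at a13
          have hcur : Current z m1 rest := by
            refine ⟨by rw [a7]; exact hti.2.2, by rw [a7, a8]; exact hti.1, ?_, by rw [a13, a7, a8]⟩
            rw [a4, a5]
            exact s5.congr fun k _ _ => by rw [a1, a2]; exact ⟨rfl, rfl, rfl⟩
          obtain ⟨t2, m2, rest', he2, hs, b2, hmerge, hcur', hlen, ht2⟩ :=
            exec_choose (M := M) hcur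
          obtain ⟨t3, ht3, m3, he3, d0, d1, d2, d3, d4, d5, d6, d7, d8, d9, d10, d11⟩ :=
            exec_store (M := M) m2
          rw [hs.idx3, a6] at d0 d1 d2 d3 d7
          rw [hs.idx5, a8] at d2
          rw [hs.idx0, a3] at d4
          have hst3 : Stored z m3 (m3.idx 1) (m3.idx 2) rest' := by
            rw [d5, d6]
            exact hcur'.stored.congr fun k _ hk => d0 k (by omega)
          obtain ⟨t4, m4, he4, ht4, f1, f2, f3, f4, f5, f6, f7⟩ :=
            ih (m := m3) (by rw [List.length_cons] at hl; omega) hcur'.tiles hst3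
              (by rw [d6, d7]; omega)
          rw [a3, a10, a11, a7, a8] at hmerge
          rw [d4, d9, d10, hs.num1, hs.num2, a10, a11] at f1 f7
          refine ⟨_, m4, .loopStep ?_ (.seq he1 (.seq he2 he3)) he4, ?_, ?_, ?_, ?_, ?_, ?_, ?_, ?_⟩
          · simpa [moreTest, Test.Holds, IdxExpr.val] using s1
          · rw [List.length_cons]
            omega
          · rw [hmerge]
            have hle := f1.le
            rw [d7] at hle f1 f2
            obtain ⟨g1, g2, g3⟩ := f2 (m.idx 3 - 1) le_rfl
            refine ⟨by omega, ?_, ?_, ?_, f1⟩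
            · rw [g1, d1]
            · rw [g2, d2]
            · rw [g3, d3, hcur'.sum, hs.idx5, a8]
          · intro j hj
            obtain ⟨g1, g2, g3⟩ := f2 j (by omega)
            obtain ⟨g1', g2', g3'⟩ := d0 j (by omega)
            rw [g1, g2, g3, g1', g2', g3', hs.idxArr, hs.numArr, a1, a2]
            exact ⟨rfl, rfl, rfl⟩
          · rw [f3, d4]
          · rw [f4, d8, hs.num0, a9]
          · rw [f5, d9, hs.num1, a10]
          · rw [f6, d10, hs.num2, a11]
          · rw [f7, d11, hmerge, List.map_cons, List.sum_cons, hcur'.sum, hs.idx0, hs.idx5, hs.num3,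
              a3, a8, a12, add_assoc]

/-- The partition that the program holds before it processes row `i`. -/
def heldPartition (M : ℕ → ℕ → ℝ) (c τ : ℝ) : ℕ → List (ℕ × ℕ)
  | 0 => []
  | i + 1 => binRow M c τ i

theorem heldPartition_tiles (M : ℕ → ℕ → ℝ) (c τ : ℝ) (i : ℕ) :
    Tiles i (heldPartition M c τ i) := by
  cases i with
  | zero => rfl
  | succ i => exact binRow_tiles M c τ i

/-- With nothing held at the start, the first row obeys the same rule as all others, so the program
needs no special case. -/
theorem binRow_eq_heldPartition (M : ℕ → ℕ → ℝ) (c τ : ℝ) (i : ℕ) :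
    binRow M c τ i = (i, i) :: mergePass (M i) c τ (heldPartition M c τ i) := by
  cases i with
  | zero => simp [heldPartition, mergePass, binRow]
  | succ i => rfl

/-- The state of the memory before row `i`. -/
structure Ready (M : ℕ → ℕ → ℝ) (z : ℕ → ℝ) (c τ : ℝ) (i : ℕ) (m : Memory) : Prop where
  idx0 : m.idx 0 = i
  num1 : m.num 1 = c
  num2 : m.num 2 = τ
  stored : Stored z m (m.idx 1) i (heldPartition M c τ i)

theorem ready_start (M : ℕ → ℕ → ℝ) (z : ℕ → ℝ) (c τ : ℝ) : Ready M z c τ 0 (start c τ) := by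
  constructor <;> simp [start, heldPartition, Stored]

theorem Ready.exec_row {c τ : ℝ} {i : ℕ} {m : Memory} (h : Ready M z c τ i m) :
    ∃ t m', Exec M rowProg (feed m (z i)) t m' ∧
      t ≤ 200 * (heldPartition M c τ i).length + 60 ∧ Ready M z c τ (i + 1) m' ∧
      m'.num 3 = ((binRow M c τ i).map fun I =>
        (M i I.1 + M i I.2) / 2 * ∑ j ∈ Finset.Ico I.1 (I.2 + 1), z j).sum := by
  obtain ⟨h0, h1, h2, hst⟩ := h
  obtain ⟨t1, ht1, m1, he1, a1, a2, a3, a4, a5, a6, a7, a8, a9, a10⟩ :=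
    exec_init (M := M) (feed m (z i))
  have k0 : (feed m (z i)).idx 0 = i := h0
  have k1 : (feed m (z i)).num 1 = c := by simpa [feed] using h1
  have k2 : (feed m (z i)).num 2 = τ := by simpa [feed] using h2
  have k3 : (feed m (z i)).num 0 = z i := by simp [feed]
  have k4 : (feed m (z i)).idx 1 = m.idx 1 := rfl
  rw [k0] at a3 a5 a6
  rw [k1] at a8
  rw [k2] at a9
  rw [k3] at a7
  rw [k4] at a4
  have hst1 : Stored z m1 (m1.idx 1) (m1.idx 2) (heldPartition M c τ i) := by
    rw [a4, a5]
    exact hst.congr fun k _ _ => by rw [a1, a2]; exact ⟨rfl, rfl, rfl⟩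
  obtain ⟨t2, m2, he2, ht2, b1, b2, b3, b4, b5, b6, b7⟩ :=
    exec_pass (M := M) _ le_rfl (heldPartition_tiles M c τ i) hst1 (by rw [a5, a6])
  rw [a3, a8, a9, a6] at b1
  rw [a3, a8, a9, a10] at b7
  rw [a3] at b3
  rw [a7] at b4
  rw [a8] at b5
  rw [a9] at b6
  obtain ⟨t3, ht3, m3, he3, d0, d1, d2, d3, d4, d5, d6, d7, d8⟩ := exec_push (M := M) m2
  rw [b3] at d0 d1 d2 d3 d4 d8
  rw [b4] at d3 d8
  have hi : intervalSum z i i = z i := by simp [intervalSum]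
  refine ⟨_, m3, .seq he1 (.seq he2 he3), by omega, ⟨d4, by rw [d6, b5], by rw [d7, b6], ?_⟩, ?_⟩
  · rw [heldPartition, binRow_eq_heldPartition, d5]
    have hle := b1.le
    refine ⟨by omega, d1, d2, by rw [Nat.add_sub_cancel, d3, hi], ?_⟩
    rw [Nat.add_sub_cancel]
    exact b1.congr fun k _ hk => d0 k (by omega)
  · rw [binRow_eq_heldPartition, List.map_cons, List.sum_cons, d8, b7, zero_add, add_comm]
    change (M i i + M i i) / 2 * z i + _ = (M i i + M i i) / 2 * intervalSum z i i + _
    rw [hi]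
    rfl

end correctness

theorem computesOnline_binApprox {n : ℕ} (L : Matrix (Fin n) (Fin n) ℝ) (c τ : ℝ)
    (z : Fin n → ℝ) :
    ComputesOnline rowProg L c τ (binApprox L c τ) z (260 * binningSize (binningOf L c τ)) := by
  set z' := extendByZero n z with hz'
  -- The existential stands in front of the implication so that `choose` yields a total successor
  -- function, by which the sequence of memories is defined recursively.
  have hstep : ∀ i m, ∃ m', Ready (entryAt L) z' c τ i m →
      ∃ t, Exec (entryAt L) rowProg (feed m (z' i)) t m' ∧
      t ≤ 200 * (heldPartition (entryAt L) c τ i).length + 60 ∧ Ready (entryAt L) z' c τ (i + 1) m' ∧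
      m'.num 3 = ((binRow (entryAt L) c τ i).map fun I =>
        (entryAt L i I.1 + entryAt L i I.2) / 2 * ∑ j ∈ Finset.Ico I.1 (I.2 + 1), z' j).sum := by
    intro i m
    by_cases h : Ready (entryAt L) z' c τ i m
    · obtain ⟨t, m', h'⟩ := h.exec_row
      exact ⟨m', fun _ => ⟨t, h'⟩⟩
    · exact ⟨m, fun h' => absurd h' h⟩
  choose next hnext using hstep
  set s : ℕ → Memory := fun i => Nat.rec (start c τ) next i with hs
  have hready : ∀ i, Ready (entryAt L) z' c τ i (s i) := by
    intro i
    induction i with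
    | zero => exact ready_start _ _ _ _
    | succ i ih =>
        obtain ⟨t, -, -, h, -⟩ := hnext i (s i) ih
        exact h
  refine ⟨fun i => s i, rfl, fun i => ?_⟩
  obtain ⟨t, he, ht, -, hout⟩ := hnext i (s i) (hready i)
  have hzi : z' i = z i := extendByZero_apply z i
  rw [hzi] at he
  refine ⟨⟨t, ?_, he⟩, ?_⟩
  · have h1 : (heldPartition (entryAt L) c τ i).length ≤ binningSize (binningOf L c τ) := by
      obtain ⟨i, hi⟩ := i
      cases i with
      | zero => exact Nat.zero_le _
      | succ i => exact length_binRow_le_binningSize L c τ ⟨i, by omega⟩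
    -- Each row has at least its singleton, so the size is at least `1` and the additive `60` is
    -- absorbed: `200 + 60 = 260`.
    have h2 := length_binRow_le_binningSize L c τ i
    rw [binRow_eq_heldPartition, List.length_cons] at h2
    omega
  · have hz : z = fun j : Fin n => z' j := by
      funext j; rw [hz', extendByZero_apply]
    rw [hz, binApprox_mulVec]
    exact hout

end RealRAM

/-! ### The choice of the parameters -/

theorem one_le_sum_sqrtCoeff {α β : ℝ} (hβ : 0 ≤ β) (hαβ : β < α) {n : ℕ} (hn : 1 ≤ n) :
    1 ≤ ∑ k ∈ Finset.range n, sqrtCoeff α β k := by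
  rw [← sqrtCoeff_zero α β]
  exact Finset.single_le_sum (f := sqrtCoeff α β) (fun k _ => (sqrtCoeff_pos hβ hαβ k).le)
    (Finset.mem_range.2 hn)

/-- From `1 - x ≤ exp (-x)`, with `k` the least integer above `(S/κ) log (1/τ)`. -/
theorem exists_pow_le {κ S τ : ℝ} (hκ : 0 < κ) (hκ1 : κ < 1) (hS : 1 ≤ S) (hτ : 0 < τ)
    (hτ1 : τ < 1) :
    ∃ k : ℕ, (1 - κ / S) ^ k ≤ τ ∧ (k : ℝ) ≤ S / κ * Real.log (1 / τ) + 1 := by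
  have hS0 : 0 < S := by linarith
  have hlog : 0 ≤ Real.log (1 / τ) := Real.log_nonneg (by rw [le_div_iff₀ hτ]; linarith)
  refine ⟨⌈S / κ * Real.log (1 / τ)⌉₊, ?_, (Nat.ceil_lt_add_one (by positivity)).le⟩
  set k := ⌈S / κ * Real.log (1 / τ)⌉₊
  have hk : S / κ * Real.log (1 / τ) ≤ k := Nat.le_ceil _
  have h0 : 0 ≤ 1 - κ / S := by
    rw [sub_nonneg, div_le_one hS0]
    linarith
  calc (1 - κ / S) ^ k ≤ Real.exp (-(κ / S)) ^ k :=
        pow_le_pow_left₀ h0 (Real.one_sub_le_exp_neg _) k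
    _ = Real.exp (-(k * (κ / S))) := by rw [← Real.exp_nat_mul]; ring_nf
    _ ≤ Real.exp (Real.log τ) := by
        apply Real.exp_le_exp.2
        have h1 : Real.log (1 / τ) ≤ k * (κ / S) := by
          calc Real.log (1 / τ) = S / κ * Real.log (1 / τ) * (κ / S) := by field_simp
            _ ≤ _ := mul_le_mul_of_nonneg_right hk (by positivity)
        rw [one_div, Real.log_inv] at h1
        linarith
    _ = τ := Real.exp_log hτ

/-- The constant in the bound on the size of the binning. -/
def sizeConst (κ : ℝ) : ℝ := 2 / κ * (1 + Real.log (1 / κ) / Real.log 2) + 4 / Real.log 2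

theorem sizeConst_nonneg {κ : ℝ} (hκ : 0 < κ) (hκ1 : κ < 1) : 0 ≤ sizeConst κ := by
  have h1 : 0 ≤ Real.log (1 / κ) := Real.log_nonneg (by rw [le_div_iff₀ hκ]; linarith)
  have h2 : 0 < Real.log 2 := Real.log_pos (by norm_num)
  unfold sizeConst
  positivity

theorem binningSize_le {α β κ : ℝ} (hβ : 0 ≤ β) (hαβ : β < α) (hα : α ≤ 1) (hκ : 0 < κ)
    (hκ1 : κ < 1) {n : ℕ} (hn : 2 ≤ n) :
    (binningSize (binningOf (sqrtCountingMatrix α β n)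
        (1 - κ / ∑ k ∈ Finset.range n, sqrtCoeff α β k) (κ / n)) : ℝ) ≤
      sizeConst κ * ((∑ k ∈ Finset.range n, sqrtCoeff α β k) * Real.log n) := by
  have hS := one_le_sum_sqrtCoeff hβ hαβ (show 1 ≤ n by omega)
  set S := ∑ k ∈ Finset.range n, sqrtCoeff α β k
  have hS0 : 0 < S := by linarith
  have hn2 : (2 : ℝ) ≤ n := by exact_mod_cast hn
  have hκS : κ / S ≤ κ := div_le_self hκ.le hS
  have hκS0 : 0 < κ / S := by positivity
  have hτ1 : κ / n < 1 := by rw [div_lt_one (by linarith)]; linarith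
  obtain ⟨k, hk, hk'⟩ := exists_pow_le hκ hκ1 hS (show 0 < κ / n by positivity) hτ1
  have hsize : binningSize (binningOf (sqrtCountingMatrix α β n) (1 - κ / S) (κ / n)) ≤
      2 * k + 2 := by
    apply Finset.sup_le
    intro i _
    exact (List.toFinset_card_le _).trans
      (length_binRow_le hβ hαβ hα (by linarith) (by linarith) hk i i.2)
  have hsize' : (binningSize (binningOf (sqrtCountingMatrix α β n) (1 - κ / S) (κ / n)) : ℝ) ≤
      2 * k + 2 := by exact_mod_cast hsize
  refine hsize'.trans ?_
  have hlog2 : 0 < Real.log 2 := Real.log_pos (by norm_num)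
  have hlogn : Real.log 2 ≤ Real.log n := Real.log_le_log (by norm_num) hn2
  have hlogκ : 0 ≤ Real.log (1 / κ) := Real.log_nonneg (by rw [le_div_iff₀ hκ]; linarith)
  have hτlog : Real.log (1 / (κ / n)) = Real.log n + Real.log (1 / κ) := by
    rw [← Real.log_mul (by linarith) (by positivity)]
    congr 1
    field_simp
  -- Here `n ≥ 2` turns the constants `log (1/κ)` and `4` into multiples of `log n`; this explains
  -- the form of `sizeConst`.
  have h1 : Real.log (1 / κ) ≤ Real.log (1 / κ) / Real.log 2 * Real.log n := by
    rw [div_mul_eq_mul_div, le_div_iff₀ hlog2]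
    exact mul_le_mul_of_nonneg_left hlogn hlogκ
  have h2 : (4 : ℝ) ≤ 4 / Real.log 2 * (S * Real.log n) := by
    rw [div_mul_eq_mul_div, le_div_iff₀ hlog2]
    nlinarith
  rw [hτlog] at hk'
  have h3 : S / κ * (Real.log n + Real.log (1 / κ)) ≤
      S / κ * ((1 + Real.log (1 / κ) / Real.log 2) * Real.log n) :=
    mul_le_mul_of_nonneg_left (by linarith) (by positivity)
  calc 2 * (k : ℝ) + 2 ≤
        2 * (S / κ * ((1 + Real.log (1 / κ) / Real.log 2) * Real.log n)) + 4 := by linarith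
    _ ≤ 2 * (S / κ * ((1 + Real.log (1 / κ) / Real.log 2) * Real.log n)) +
        4 / Real.log 2 * (S * Real.log n) := by linarith
    _ = sizeConst κ * (S * Real.log n) := by
        unfold sizeConst
        ring

/-- With `κ = ξ/200` the row norms contribute at most `(1 + 5κ)² = (1 + ξ/40)²` and the sensitivity
`(1 - 20κ)⁻² = (1 - ξ/10)⁻²`. -/
theorem error_constant_le {ξ S : ℝ} (hξ : 0 < ξ) (hξ1 : ξ < 1) (hS : 1 ≤ S) {n : ℕ} (hn : 1 ≤ n) :
    (1 + (4 * (1 - (1 - ξ / 200 / S)) + n * (ξ / 200 / n))) ^ 2 *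
      ((1 - 4 * (5 * (ξ / 200)))⁻¹) ^ 2 ≤ 1 + ξ := by
  have hn0 : (n : ℝ) ≠ 0 := by positivity
  have hS' : ξ / 200 / S ≤ ξ / 200 := div_le_self (by positivity) hS
  have hS0 : 0 ≤ ξ / 200 / S := by positivity
  rw [mul_div_cancel₀ _ hn0, ← mul_pow, ← div_eq_mul_inv, div_pow,
    div_le_iff₀ (pow_pos (by linarith) 2)]
  calc _ ≤ (1 + ξ / 40) ^ 2 := pow_le_pow_left₀ (by linarith) (by linarith) 2
    _ ≤ _ := by nlinarith [mul_pos hξ hξ, mul_pos (mul_pos hξ hξ) hξ]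

theorem mainTheorem2 :
    ∃ (prog : RealRAM.Prog) (K : ℕ),
      ∀ α β ξ : ℝ, 0 ≤ β → β < α → α ≤ 1 → 0 < ξ → ξ < 1 →
        ∃ C : ℝ, ∀ n : ℕ, 1 ≤ n →
          ∃ c τ : ℝ, 0 < c ∧ c < 1 ∧ 0 < τ ∧ τ < 1 ∧
            ∃ B Lhat Rhat : Matrix (Fin n) (Fin n) ℝ,
            ∃ P : Fin n → Finset (ℕ × ℕ),
              -- the square root, its binning, the approximation, the induced factorization
              B = sqrtCountingMatrix α β n ∧ B * B = countingMatrix α β n ∧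
              P = binningOf B c τ ∧ IsBinning P ∧
              IsBinApprox P B Lhat ∧
              IsUnit Lhat.det ∧ Rhat = Lhat⁻¹ * (B * B) ∧ Lhat * Rhat = B * B ∧
              -- the size of the binning
              (2 ≤ n → α = 1 → (binningSize P : ℝ) ≤ C * (√(n : ℝ) * Real.log n)) ∧
              (2 ≤ n → α ≠ 1 → (binningSize P : ℝ) ≤ C * Real.log n) ∧
              -- the errors
              (∀ ε δ : ℝ, 0 < ε → ε < 1 → 0 < δ → δ < 1 →
                meanSE ε δ Lhat Rhat ≤ (1 + ξ) * meanSE ε δ B B ∧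
                maxSE ε δ Lhat Rhat ≤ (1 + ξ) * maxSE ε δ B B) ∧
              -- space and time per output
              spaceComplexity Lhat ≤ (binningSize P : ℕ∞) ∧
              ∀ z : Fin n → ℝ,
                RealRAM.ComputesOnline prog B c τ Lhat z (K * binningSize P) := by
  refine ⟨RealRAM.rowProg, 260, fun α β ξ hβ hαβ hα hξ hξ1 => ?_⟩
  set κ := ξ / 200 with hκ
  have hκ0 : 0 < κ := by positivity
  have hκ1 : κ < 1 / 200 := by rw [hκ]; linarith
  have hC := sizeConst_nonneg hκ0 (by linarith)
  -- The second factor bounds `S`, up to `√n` in the case `α = 1`; there `β < 1`.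
  refine ⟨sizeConst κ * if α = 1 then √(2 / (1 - β)) else 1 / (1 - α), fun n hn => ?_⟩
  have hn0 : (1 : ℝ) ≤ n := by exact_mod_cast hn
  have hlog : 0 ≤ Real.log n := Real.log_nonneg hn0
  have hS := one_le_sum_sqrtCoeff hβ hαβ hn
  have hsize := fun h2 : 2 ≤ n => binningSize_le hβ hαβ hα hκ0 (by linarith) h2
  set S := ∑ k ∈ Finset.range n, sqrtCoeff α β k with hSdef
  have hS0 : 0 < S := by linarith
  have hκS : κ / S ≤ κ := div_le_self hκ0.le hS
  have hκS0 : 0 < κ / S := by positivity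
  have hc0 : 1 / 2 ≤ 1 - κ / S := by linarith
  have hc1 : 1 - κ / S < 1 := by linarith
  have hτ0 : 0 < κ / n := by positivity
  have hτ1 : κ / n < 1 := by rw [div_lt_one (by linarith)]; linarith
  have hdet : IsUnit (binApprox (sqrtCountingMatrix α β n) (1 - κ / S) (κ / n)).det := by
    rw [det_binApprox]
    exact isUnit_one
  refine ⟨1 - κ / S, κ / n, by linarith, hc1, hτ0, hτ1, sqrtCountingMatrix α β n,
    binApprox (sqrtCountingMatrix α β n) (1 - κ / S) (κ / n), _, _, rfl,
    sqrtCountingMatrix_mul_self hαβ.ne' n, rfl, isBinning_binningOf _ _ _,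
    isBinApprox_binApprox _ _ _, hdet, rfl, ?_, ?_, ?_, ?_,
    spaceComplexity_binApprox_le _ _ _, fun z => RealRAM.computesOnline_binApprox _ _ _ z⟩
  · rw [← Matrix.mul_assoc, Matrix.mul_nonsing_inv _ hdet, Matrix.one_mul]
  · intro h2 h1
    rw [if_pos h1]
    subst h1
    have hSle : S ≤ √(2 / (1 - β)) * √(n : ℝ) := by
      rw [← Real.sqrt_mul (div_nonneg (by norm_num) (by linarith))]
      apply Real.le_sqrt_of_sq_le
      rw [div_mul_eq_mul_div]
      exact sum_sqrtCoeff_sq_le hβ hαβ n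
    calc _ ≤ sizeConst κ * (S * Real.log n) := hsize h2
      _ ≤ sizeConst κ * (√(2 / (1 - β)) * √(n : ℝ) * Real.log n) :=
          mul_le_mul_of_nonneg_left (mul_le_mul_of_nonneg_right hSle hlog) hC
      _ = _ := by ring
  · intro h2 h1
    rw [if_neg h1]
    have hSle : S ≤ 1 / (1 - α) :=
      sum_sqrtCoeff_le_of_lt_one hβ hαβ (lt_of_le_of_ne hα h1) n
    calc _ ≤ sizeConst κ * (S * Real.log n) := hsize h2
      _ ≤ sizeConst κ * (1 / (1 - α) * Real.log n) :=
          mul_le_mul_of_nonneg_left (mul_le_mul_of_nonneg_right hSle hlog) hC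
      _ = _ := by ring
  · intro ε δ _ _ hδ hδ1
    -- The relative part contributes `4 (κ/S) S = 4κ`, the threshold `n (κ/n) = κ`.
    have hρ : ∑ k ∈ Finset.range n, (4 * (1 - (1 - κ / S)) * sqrtCoeff α β k + κ / n) ≤
        5 * κ := by
      rw [Finset.sum_add_distrib, ← Finset.mul_sum, ← hSdef, Finset.sum_const, Finset.card_range,
        nsmul_eq_mul]
      apply le_of_eq
      field_simp
      ring
    have hR := sensitivity_le_mul _ (sqrtCountingMatrix α β n)
      (inv_nonneg.2 (show 0 ≤ 1 - 4 * (5 * κ) by linarith))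
      (l2norm_right_factor_le hβ hαβ hα hc0 hc1 hτ0.le hρ (by linarith))
    have hrow := rowError_le (ε := ε) hδ hδ1
      (fun i => l2norm_row_le (n := n) hβ hαβ hα hc0 hc1 hτ0.le i) hR
      (error_constant_le hξ hξ1 hS hn)
    exact ⟨meanSE_le hrow, maxSE_le (by linarith) hrow⟩

end
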